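/- **Setting.** Let $r\ge 0$, $\sigma\in\mathbb R$, $a<b$, $T\ge 0$, $m\ge 1$, $M=2^m$. The time-reversed Black–Scholes equation in the logarithmic price $x$, $$\partial_\tau V=\Big(r-\frac{\sigma^2}{2}\Big)\partial_xV+\frac{\sigma^2}{2}\,\partial_{xx}V-rV ,$$ is discretised with the Fourier spectral method on $[a,b]$ with periodic boundary conditions and grid points $x_j=a+j(b-a)/M$, $0\le j<M$. Let $\mu_l=2\pi(l-M/2)/(b-a)$ for $0\le l<M$, $\Phi=(e^{i\mu_l(x_j-a)})_{j,l}$ and $P=\Phi\,\mathrm{diag}(\mu_l)\,\Phi^{-1}$. Replacing $\partial_x$ by $iP$ gives the semi-discrete equation $\mathbf V'(\tau)=A\mathbf V(\tau)$ with $$A=i\Big(r-\frac{\sigma^2}{2}\Big)P-\frac{\sigma^2}{2}P^2-rI .$$ Write $A=H_1+iH_2$ with $H_1=\frac{A+A^\dagger}{2}$ and $H_2=\frac{A-A^\dagger}{2i}$. The evolutionary unitary dilation operator for one step of length $T$ is the following operator on one dilation qubit and $m$ data qubits: $$U=\begin{bmatrix}K&\sqrt{I-K^2}\\ \sqrt{I-K^2}&-K\end{bmatrix}\big(I_2\otimes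 e^{iTH_2}\big),\qquad K=e^{TH_1}.$$ A gate is an arbitrary unitary on two qubits. A circuit may use work qubits that start in $|0\rangle$. It implements $U$ within error $\varepsilon$ if it maps $\psi\otimes|0\cdots0\rangle$ to $(U\psi)\otimes|0\cdots0\rangle$ up to an error of Euclidean norm at most $\varepsilon\|\psi\|$, for all $\psi$. **Theorem 4.2.** 1. In the momentum basis $H_1$ and $H_2$ are diagonal, $\Phi^{-1}H_1\Phi=\mathrm{diag}\big(-(\frac{\sigma^2}{2}\mu_l^2+r)\big)$ and $\Phi^{-1}H_2\Phi=\mathrm{diag}\big((r-\frac{\sigma^2}{2})\mu_l\big)$. Hence they commute, in the momentum basis and on grid values. A single dilation step suffices: $U$ is unitary, and for every solution $\mathbf V$ of $\mathbf V'=A\mathbf V$ on $[0,T]$ the $|0\rangle$-block of $U(|0\rangle\otimes\mathbf V(0))$ equals $\mathbf V(T)$. 2. The gate complexity of $U$ is $O(m\log m)$, in both of the following senses. * For every $\varepsilon>0$ there is a constant $C$, depending only on $\varepsilon$, such that for all $r\ge0$, $\sigma\in\mathbb R$, $a<b$, $T\ge0$ and $m\ge2$, $U$ is implemented within error $\varepsilon$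 by a circuit of at most $C\,m\log m$ two-qubit gates. * For all $r\ge0$, $\sigma\in\mathbb R$, $a<b$, $T\ge0$ and every integer $c\ge0$ there is a constant $C$ such that for all $m\ge2$, $U$ is implemented within error $m^{-c}$ by a circuit of at most $C\,m\log m$ two-qubit gates. -/

import Mathlib

open scoped Kronecker

noncomputable section

namespace BlackScholes

/-! ### Fourier spectral discretisation on `[a, b]` with `M = 2 ^ m` grid points -/

/-- The frequencies `μ_l = 2 π (l - M / 2) / (b - a)`, `l = 0, …, M - 1`, where `M = 2 ^ m`
(the indices start at `0`). -/
def freq (a b : ℝ) (m : ℕ) (l : Fin (2 ^ m)) : ℝ :=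
  2 * Real.pi * ((l : ℝ) - (2 : ℝ) ^ m / 2) / (b - a)

/-- The grid points `x_j = a + j (b - a) / M`. -/
def gridPoint (a b : ℝ) (m : ℕ) (j : Fin (2 ^ m)) : ℝ :=
  a + (j : ℝ) * ((b - a) / (2 : ℝ) ^ m)

/-- The Fourier matrix `Φ = (φ_l (x_j))_{j l}` with `φ_l (x) = exp (i μ_l (x - a))`; it maps
coefficients in the momentum basis to grid values. -/
def fourierMatrix (a b : ℝ) (m : ℕ) : Matrix (Fin (2 ^ m)) (Fin (2 ^ m)) ℂ :=
  Matrix.of fun j l =>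
    Complex.exp (Complex.I * (freq a b m l : ℂ) * ((gridPoint a b m j - a : ℝ) : ℂ))

/-- The discrete momentum operator `P_μ = Φ diag(μ) Φ⁻¹`, the discretisation of `-i ∂_x`. -/
def momentum (a b : ℝ) (m : ℕ) : Matrix (Fin (2 ^ m)) (Fin (2 ^ m)) ℂ :=
  fourierMatrix a b m * Matrix.diagonal (fun l => (freq a b m l : ℂ)) * (fourierMatrix a b m)⁻¹

/-- The spectral discretisation `i P_μ` of `∂_x`. -/
def spectralDeriv (a b : ℝ) (m : ℕ) : Matrix (Fin (2 ^ m)) (Fin (2 ^ m)) ℂ :=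
  Complex.I • momentum a b m

/-- The spectral discretisation of the right-hand side
`(r - σ² / 2) ∂_x V + (σ² / 2) ∂_xx V - r V` of the (time-reversed, logarithmic price)
Black-Scholes equation. -/
def generator (r σ a b : ℝ) (m : ℕ) : Matrix (Fin (2 ^ m)) (Fin (2 ^ m)) ℂ :=
  ((r - σ ^ 2 / 2 : ℝ) : ℂ) • spectralDeriv a b m
    + ((σ ^ 2 / 2 : ℝ) : ℂ) • (spectralDeriv a b m * spectralDeriv a b m)
    - (r : ℂ) • (1 : Matrix (Fin (2 ^ m)) (Fin (2 ^ m)) ℂ)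

/-- The matrix of an operator on grid values with respect to the momentum basis. -/
def inMomentumBasis (a b : ℝ) (m : ℕ) (X : Matrix (Fin (2 ^ m)) (Fin (2 ^ m)) ℂ) :
    Matrix (Fin (2 ^ m)) (Fin (2 ^ m)) ℂ :=
  (fourierMatrix a b m)⁻¹ * X * fourierMatrix a b m

/-! ### Unitary dilation of a linear evolution -/

section Dilation

variable {ι : Type*} [Fintype ι] [DecidableEq ι]

/-- The Hermitian part `H₁ = (A + A†) / 2`. -/
def hermPart (A : Matrix ι ι ℂ) : Matrix ι ι ℂ :=
  (2 : ℂ)⁻¹ • (A + A.conjTranspose)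

/-- `H₂ = (A - A†) / (2 i)`, so that `A = H₁ + i H₂`. -/
def antiHermPart (A : Matrix ι ι ℂ) : Matrix ι ι ℂ :=
  (2 * Complex.I)⁻¹ • (A - A.conjTranspose)

/-- The dilation `[K, √(1 - K²); √(1 - K²), -K]` of a Hermitian contraction `K`. The square root
is taken in the functional calculus of Hermitian matrices; the first index is the state of the
dilation qubit. -/
def dilation (K : Matrix ι ι ℂ) : Matrix (Fin 2 × ι) (Fin 2 × ι) ℂ :=
  Matrix.comp _ _ _ _ _ !![K, cfc Real.sqrt (1 - K * K); cfc Real.sqrt (1 - K * K), -K]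

/-- The evolutionary unitary dilation operator of `u' = A u = (H₁ + i H₂) u` for one step of
length `T`: the dilation of `exp (T H₁)` times `1 ⊗ exp (i T H₂)`. -/
def evolutionDilation (A : Matrix ι ι ℂ) (T : ℝ) : Matrix (Fin 2 × ι) (Fin 2 × ι) ℂ :=
  dilation (NormedSpace.exp ((T : ℂ) • hermPart A)) *
    ((1 : Matrix (Fin 2) (Fin 2) ℂ) ⊗ₖ
      NormedSpace.exp ((Complex.I * (T : ℂ)) • antiHermPart A))

/-- The vector `|0⟩ ⊗ v`. -/
def ketZero (v : ι → ℂ) : Fin 2 × ι → ℂ :=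
  fun p => if p.1 = 0 then v p.2 else 0

end Dilation

/-! ### Quantum circuits of two-qubit gates -/

/-- A two-qubit gate on a register whose qubits are labelled by `Q`: an arbitrary unitary on an
ordered pair of distinct qubits. -/
structure TwoQubitGate (Q : Type) where
  fst : Q
  snd : Q
  ne : fst ≠ snd
  op : Matrix (Fin 2 × Fin 2) (Fin 2 × Fin 2) ℂ
  isUnitary : op ∈ Matrix.unitaryGroup (Fin 2 × Fin 2) ℂ

section Circuit

variable {Q : Type} [Fintype Q] [DecidableEq Q]

/-- The action of a gate on the whole register, whose basis states are the bit strings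
`Q → Fin 2`: it acts as `op` on its two qubits and as the identity on all others. -/
def TwoQubitGate.toMatrix (g : TwoQubitGate Q) : Matrix (Q → Fin 2) (Q → Fin 2) ℂ :=
  Matrix.of fun x y =>
    if ∀ k, k ≠ g.fst → k ≠ g.snd → x k = y k then
      g.op (x g.fst, x g.snd) (y g.fst, y g.snd)
    else 0

/-- The operator of a circuit, a list of gates of which the first one is applied first. -/
def circuitMatrix : List (TwoQubitGate Q) → Matrix (Q → Fin 2) (Q → Fin 2) ℂ
  | [] => 1
  | g :: gs => circuitMatrix gs * g.toMatrix

end Circuit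

/-- The qubits of a circuit: `m` data qubits, the dilation qubit, and `w` work qubits. -/
abbrev Qubits (m w : ℕ) : Type := Fin m ⊕ Unit ⊕ Fin w

/-- The bit string of the basis state `|c⟩ ⊗ |j⟩`: the data qubits hold the binary digits of `j`,
the dilation qubit holds `c`, and all work qubits hold `0`. -/
def encode (m w : ℕ) (p : Fin 2 × Fin (2 ^ m)) : Qubits m w → Fin 2 :=
  Sum.elim (finFunctionFinEquiv.symm p.2) (Sum.elim (fun _ => p.1) (fun _ => 0))

/-- The isometry `ψ ↦ ψ ⊗ |0 … 0⟩` that adjoins the work qubits. -/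
def adjoinWork (m w : ℕ) : Matrix (Qubits m w → Fin 2) (Fin 2 × Fin (2 ^ m)) ℂ :=
  Matrix.of fun x p => if x = encode m w p then 1 else 0

/-- `U` can be implemented within error `ε` by at most `G` two-qubit gates: there is a circuit of
at most `G` gates, possibly with work qubits that start in the state `|0⟩`, that maps every
`ψ ⊗ |0 … 0⟩` to `(U ψ) ⊗ |0 … 0⟩` up to an error of Euclidean norm at most `ε ‖ψ‖`. -/
def ImplementableWithin (m : ℕ) (U : Matrix (Fin 2 × Fin (2 ^ m)) (Fin 2 × Fin (2 ^ m)) ℂ)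
    (ε G : ℝ) : Prop :=
  ∃ (w : ℕ) (circ : List (TwoQubitGate (Qubits m w))), (circ.length : ℝ) ≤ G ∧
    ∀ ψ : Fin 2 × Fin (2 ^ m) → ℂ,
      ‖WithLp.toLp 2
          ((circuitMatrix circ * adjoinWork m w - adjoinWork m w * U).mulVec ψ)‖
        ≤ ε * ‖WithLp.toLp 2 ψ‖

end BlackScholes

end

open scoped Kronecker

noncomputable section

namespace BlackScholes

open Matrix

/-! ### Multiplexers -/

section Mux

set_option linter.unusedSectionVars false

variable {Q : Type} [Fintype Q] [DecidableEq Q]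

/-! Everything is diagonal in the Fourier basis. If `F` is the unitary Fourier matrix, then `A = F
diag(x + iy) F†` with `x = -(σ²μ²/2 + r) ≤ 0` and `y = (r - σ²/2) μ`. Hermitian parts, exponentials
and the functional calculus act on the eigenvalues, so `U` is `F` conjugating phases `e^{iTy}` times
one 2×2 reflection per mode, with first entry `k = e^{Tx}` (`evolutionDilation_conjDiag`). The first
part of the theorem then reduces to scalar facts: `k ≤ 1`, and each mode of a solution is multiplied
by `e^{T(x + iy)}`.

For the gate count the three factors are treated separately, on bit strings. (a) `F` is an inverse
quantum Fourier transform; the bit reversal and the shift of the frequencies by `M/2` are absorbed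
into the labelling of the modes in two's complement (`fourierMatrix_eq`). Dropping rotations between
qubits at distance more than `t` costs an error `π/2^t` per step (`norm_qft_sub_le`), so `t = O(log
m)` suffices and `O(m log m)` gates remain. (b) The phases are linear in the bits of the wave number
`N`, hence products of `m` one-qubit gates. (c) The entry `k` is `e^{-Tr}` times the Gaussian
`e^{-(δN)²}`. Where it is small, the reflection is nearly `X`, independent of `N`. The other wave
numbers are grouped into cells of length `2^K` on which the Gaussian is nearly constant. A cell is a
prefix of the bit string, and a reflection controlled by a prefix costs `O(m)` gates by a ladder of
Toffoli gates (`impl_prefix_ctrl`).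

With at most `2L + 1` cells the total is `m (2t + 26L + 17)` (`exists_implementable`). For fixed `ε`
the scale `K` is adapted to `δ`, so that `L` depends on `ε` alone (`exists_scale`). For accuracy
`m^{-c}` and fixed `δ > 0`, cells of length one suffice: only `O(log m)` modes have a non-negligible
`k`. -/

/-- The operator that applies the matrix `f y` to the qubit `t`, where `y` is the state of the
other qubits (the bit `t` of `y` is set to `0`). -/
def mux (t : Q) (f : (Q → Fin 2) → Matrix (Fin 2) (Fin 2) ℂ) :
    Matrix (Q → Fin 2) (Q → Fin 2) ℂ :=
  (blockDiagonal fun z => f ((Equiv.funSplitAt t (Fin 2)).symm (0, z))).submatrix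
    (Equiv.funSplitAt t (Fin 2)) (Equiv.funSplitAt t (Fin 2))

theorem mux_apply (t : Q) (f : (Q → Fin 2) → Matrix (Fin 2) (Fin 2) ℂ) (x y : Q → Fin 2) :
    mux t f x y =
      if ∀ k, k ≠ t → x k = y k then f (Function.update y t 0) (x t) (y t) else 0 := by
  have h1 : (Equiv.funSplitAt t (Fin 2)).symm (0, fun j : {j // j ≠ t} => x j)
      = Function.update x t 0 := by
    funext k
    by_cases hk : k = t
    · subst hk; simp [Equiv.funSplitAt]
    · simp [Equiv.funSplitAt, hk]
  by_cases h : ∀ k, k ≠ t → x k = y k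
  · have h2 : Function.update x t 0 = Function.update y t 0 := by
      funext k
      by_cases hk : k = t
      · subst hk; simp
      · simp [hk, h k hk]
    have h3 : (fun j : {j // j ≠ t} => x j) = fun j : {j // j ≠ t} => y j := by
      funext j; exact h j j.2
    rw [if_pos h]
    simp only [mux, submatrix_apply, blockDiagonal_apply, Equiv.funSplitAt_apply, h3, if_true]
    rw [← h3, h1, h2]
  · have h3 : ¬ (fun j : {j // j ≠ t} => x j) = fun j : {j // j ≠ t} => y j := by
      intro h4
      exact h fun k hk => congrFun h4 ⟨k, hk⟩
    simp only [mux, submatrix_apply, blockDiagonal_apply, Equiv.funSplitAt_apply, h, h3, if_false]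

theorem mux_mul (t : Q) (f g : (Q → Fin 2) → Matrix (Fin 2) (Fin 2) ℂ) :
    mux t f * mux t g = mux t fun y => f y * g y := by
  rw [mux, mux, submatrix_mul_equiv, ← blockDiagonal_mul]; rfl

theorem mux_conjTranspose (t : Q) (f : (Q → Fin 2) → Matrix (Fin 2) (Fin 2) ℂ) :
    (mux t f)ᴴ = mux t fun y => (f y)ᴴ := by
  rw [mux, conjTranspose_submatrix, blockDiagonal_conjTranspose]; rfl

theorem mux_one (t : Q) : mux t (fun _ => 1) = 1 := by
  ext x y
  rw [mux_apply]
  by_cases h : x = y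
  · subst h; simp
  · rw [one_apply_ne h]
    split_ifs with h'
    · rw [one_apply_ne]
      intro ht
      exact h (funext fun k => by by_cases hk : k = t; exacts [hk ▸ ht, h' k hk])
    · rfl

/-- The matrix whose columns are the basis states `g i`. -/
def basisCols {ι : Type*} (g : ι → Q → Fin 2) : Matrix (Q → Fin 2) ι ℂ :=
  of fun x i => if x = g i then 1 else 0

theorem mul_basisCols {κ ι : Type*} (A : Matrix κ (Q → Fin 2) ℂ) (g : ι → Q → Fin 2) (x : κ)
    (i : ι) : (A * basisCols g) x i = A x (g i) := by
  simp [mul_apply, basisCols]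

theorem basisCols_isometry {ι : Type*} [Fintype ι] [DecidableEq ι] {g : ι → Q → Fin 2}
    (hg : Function.Injective g) : (basisCols g)ᴴ * basisCols g = 1 := by
  ext i j
  rw [mul_basisCols, conjTranspose_apply, one_apply]
  simp only [basisCols, of_apply, hg.eq_iff]
  by_cases h : i = j
  · simp [h]
  · simp [h, Ne.symm h]

/-- The one-qubit operator `X`. -/
def pauliX : Matrix (Fin 2) (Fin 2) ℂ := !![0, 1; 1, 0]

theorem pauliX_apply (a b : Fin 2) : pauliX a b = if a = 1 - b then 1 else 0 := by
  fin_cases a <;> fin_cases b <;> simp [pauliX]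

theorem ite_and' {p q r : Prop} [Decidable p] [Decidable q] [Decidable r] (h : r ↔ p ∧ q) :
    (if r then (1 : ℂ) else 0) = if p then if q then 1 else 0 else 0 := by
  rw [← ite_and]; simp only [h]

/-- Flips the qubit `t` if the other qubits satisfy `P`. -/
def flipIf (t : Q) (P : (Q → Fin 2) → Prop) [DecidablePred P] (y : Q → Fin 2) : Q → Fin 2 :=
  if P (Function.update y t 0) then Function.update y t (1 - y t) else y

theorem mux_pauliX_mul_basisCols {ι : Type*} (t : Q) (P : (Q → Fin 2) → Prop) [DecidablePred P]
    (g : ι → Q → Fin 2) :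
    mux t (fun y => if P y then pauliX else 1) * basisCols g
      = basisCols fun i => flipIf t P (g i) := by
  ext x i
  rw [mul_basisCols, mux_apply]
  simp only [basisCols, of_apply, flipIf]
  have key : ∀ b : Fin 2, x = Function.update (g i) t b ↔
      (∀ k, k ≠ t → x k = g i k) ∧ x t = b := fun b => by
    constructor
    · rintro rfl
      exact ⟨fun k hk => by simp [hk], by simp⟩
    · rintro ⟨h1, h2⟩
      funext k
      by_cases hk : k = t
      · subst hk; simpa using h2
      · simpa [hk] using h1 k hk
  by_cases hP : P (Function.update (g i) t 0)
  · simp only [hP, if_true, pauliX_apply]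
    rw [ite_and' (key _)]
  · simp only [hP, if_false, one_apply]
    have h0 : x = g i ↔ (∀ k, k ≠ t → x k = g i k) ∧ x t = g i t := by
      have := key (g i t)
      rwa [Function.update_eq_self] at this
    rw [ite_and' h0]

theorem basisCols_self : basisCols (fun y : Q → Fin 2 => y) = 1 := by
  ext x y; simp [basisCols, one_apply]

/-- A multiplexer is conjugated by a controlled `X` on another qubit into the multiplexer with
the permuted control values. -/
theorem pauliX_conj_mux (s t : Q) (hst : s ≠ t) (P : (Q → Fin 2) → Prop) [DecidablePred P]
    (hP : ∀ y b c, P (Function.update (Function.update y s b) t c) ↔ P y)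
    (f : (Q → Fin 2) → Matrix (Fin 2) (Fin 2) ℂ) :
    mux s (fun y => if P y then pauliX else 1) * mux t f *
        mux s (fun y => if P y then pauliX else 1)
      = mux t fun y => f (flipIf s P y) := by
  have hP1 : ∀ y b, P (Function.update y s b) ↔ P y := fun y b => by
    simpa using hP y b (Function.update y s b t)
  have hP2 : ∀ y b, P (Function.update y t b) ↔ P y := fun y b => by
    simpa using hP y (y s) b
  set C := mux s (fun y => if P y then pauliX else 1) with hC
  have hCC : Cᴴ = C := by
    rw [hC, mux_conjTranspose]
    congr 1; funext y
    split_ifs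
    · ext a b; fin_cases a <;> fin_cases b <;> simp [pauliX]
    · simp
  have hc : ∀ (A : Matrix (Q → Fin 2) (Q → Fin 2) ℂ) x y, (A * C) x y = A x (flipIf s P y) := by
    intro A x y
    -- With the identity as labelling, `basisCols` is the identity matrix, so the controlled `X` is
    -- read off as the permutation matrix of `flipIf`.
    have h := mux_pauliX_mul_basisCols s P (fun y : Q → Fin 2 => y)
    rw [basisCols_self, mul_one] at h
    rw [hC, h, mul_basisCols]
  have hr : ∀ (A : Matrix (Q → Fin 2) (Q → Fin 2) ℂ) x y, (C * A) x y = A (flipIf s P x) y := by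
    intro A x y
    have h := hc Aᴴ y x
    have h2 : Aᴴ * C = (C * A)ᴴ := by rw [conjTranspose_mul, hCC]
    rw [h2, conjTranspose_apply, conjTranspose_apply] at h
    exact star_injective h
  have hinv : ∀ y, flipIf s P (flipIf s P y) = y := by
    intro y
    by_cases h : P y
    · simp only [flipIf, hP1, h, if_true]
      funext k
      by_cases hk : k = s
      · subst hk; simp
      · simp [hk]
    · simp [flipIf, hP1, h]
  ext x y
  rw [hc, hr, mux_apply, mux_apply]
  have e1 : (flipIf s P x) t = x t := by
    simp only [flipIf]; split_ifs <;> simp [Ne.symm hst]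
  have e2 : (flipIf s P y) t = y t := by
    simp only [flipIf]; split_ifs <;> simp [Ne.symm hst]
  have e3 : Function.update (flipIf s P y) t 0 = flipIf s P (Function.update y t 0) := by
    simp only [flipIf, hP1, hP2]
    split_ifs
    · rw [Function.update_comm (Ne.symm hst)]; simp [hst]
    · rfl
  have e4 : (∀ k, k ≠ t → flipIf s P x k = flipIf s P y k) ↔ (∀ k, k ≠ t → x k = y k) := by
    have aux : ∀ x y : Q → Fin 2, (∀ k, k ≠ t → x k = y k) →
        ∀ k, k ≠ t → flipIf s P x k = flipIf s P y k := by
      intro x y h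
      have h5 : x = Function.update y t (x t) := by
        funext k
        by_cases hk : k = t
        · subst hk; simp
        · simp [hk, h k hk]
      have h6 : P x ↔ P y := by rw [h5]; exact hP2 _ _
      intro k hk
      simp only [flipIf, hP1, h6]
      split_ifs
      · by_cases hks : k = s
        · subst hks; simp [h k hk]
        · simp [hks, h k hk]
      · exact h k hk
    refine ⟨fun h => ?_, aux x y⟩
    have := aux _ _ h
    rwa [hinv, hinv] at this
  simp only [e1, e2, e3, e4]

/-! ### Gates as multiplexers -/

/-- The gate that applies `V (y q)` to the qubit `t`. -/
def ctrlGate (q t : Q) (h : q ≠ t) (V : Fin 2 → Matrix (Fin 2) (Fin 2) ℂ)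
    (hV : ∀ b, V b ∈ unitaryGroup (Fin 2) ℂ) : TwoQubitGate Q where
  fst := q
  snd := t
  ne := h
  op := of fun u v => if u.1 = v.1 then V v.1 u.2 v.2 else 0
  isUnitary := by
    rw [mem_unitaryGroup_iff']
    ext ⟨a, b⟩ ⟨c, d⟩
    have h1 := congrFun (congrFun ((mem_unitaryGroup_iff').1 (hV a)) b) d
    simp only [star_eq_conjTranspose, mul_apply, conjTranspose_apply, one_apply] at h1
    simp only [star_eq_conjTranspose, mul_apply, conjTranspose_apply, one_apply, of_apply,
      Fintype.sum_prod_type, Prod.mk.injEq]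
    rw [Finset.sum_eq_single a]
    · by_cases hac : a = c
      · subst hac; simpa using h1
      · simp [hac]
    · intro k _ hk; simp [hk]
    · simp

theorem ctrlGate_toMatrix (q t : Q) (h : q ≠ t) (V : Fin 2 → Matrix (Fin 2) (Fin 2) ℂ)
    (hV : ∀ b, V b ∈ unitaryGroup (Fin 2) ℂ) :
    (ctrlGate q t h V hV).toMatrix = mux t fun y => V (y q) := by
  ext x y
  rw [mux_apply]
  simp only [TwoQubitGate.toMatrix, ctrlGate, of_apply, Function.update_of_ne h]
  by_cases h1 : ∀ k, k ≠ t → x k = y k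
  · rw [if_pos (fun k _ hk => h1 k hk), if_pos (h1 q h), if_pos h1]
  · rw [if_neg h1]
    split_ifs with h2 h3
    · exact absurd (fun k hk => by
        by_cases hq : k = q
        · rw [hq, h3]
        · exact h2 k hq hk) h1
    · rfl
    · rfl

/-- The adjoint gate. -/
def TwoQubitGate.adj (g : TwoQubitGate Q) : TwoQubitGate Q where
  fst := g.fst
  snd := g.snd
  ne := g.ne
  op := g.opᴴ
  isUnitary := Unitary.star_mem g.isUnitary

theorem TwoQubitGate.adj_toMatrix (g : TwoQubitGate Q) : g.adj.toMatrix = g.toMatrixᴴ := by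
  ext x y
  rw [conjTranspose_apply]
  change (if ∀ k, k ≠ g.fst → k ≠ g.snd → x k = y k then _ else _)
    = star (if ∀ k, k ≠ g.fst → k ≠ g.snd → y k = x k then _ else _)
  rw [apply_ite star, star_zero]
  exact if_congr (by simp only [eq_comm]) rfl rfl

/-- The operator on the register is unitary and is the operator of a circuit of at most `n`
gates. -/
def Realizes (A : Matrix (Q → Fin 2) (Q → Fin 2) ℂ) (n : ℕ) : Prop :=
  A ∈ unitaryGroup (Q → Fin 2) ℂ ∧ ∃ c : List (TwoQubitGate Q), c.length ≤ n ∧ circuitMatrix c = A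

theorem circuitMatrix_append (c d : List (TwoQubitGate Q)) :
    circuitMatrix (c ++ d) = circuitMatrix d * circuitMatrix c := by
  induction c with
  | nil => simp [circuitMatrix]
  | cons g c ih => simp [circuitMatrix, ih, Matrix.mul_assoc]

theorem circuitMatrix_adj (c : List (TwoQubitGate Q)) :
    circuitMatrix (c.map TwoQubitGate.adj).reverse = (circuitMatrix c)ᴴ := by
  induction c with
  | nil => simp [circuitMatrix]
  | cons g c ih =>
    simp [circuitMatrix, circuitMatrix_append, ih, conjTranspose_mul, TwoQubitGate.adj_toMatrix]

theorem Realizes.conjTranspose_mul_self {A : Matrix (Q → Fin 2) (Q → Fin 2) ℂ} {n : ℕ}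
    (h : Realizes A n) : Aᴴ * A = 1 :=
  mem_unitaryGroup_iff'.1 h.1

theorem Realizes.mul {A B : Matrix (Q → Fin 2) (Q → Fin 2) ℂ} {a b : ℕ} (hA : Realizes A a)
    (hB : Realizes B b) : Realizes (A * B) (a + b) := by
  obtain ⟨hA, c, hc, rfl⟩ := hA
  obtain ⟨hB, d, hd, rfl⟩ := hB
  -- Gates are listed in order of application, so the circuit of the right factor comes first.
  exact ⟨mul_mem hA hB, d ++ c, by simp; omega, circuitMatrix_append d c⟩

theorem Realizes.adj {A : Matrix (Q → Fin 2) (Q → Fin 2) ℂ} {a : ℕ} (hA : Realizes A a) :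
    Realizes Aᴴ a := by
  obtain ⟨hA, c, hc, rfl⟩ := hA
  exact ⟨Unitary.star_mem hA, (c.map TwoQubitGate.adj).reverse, by simpa using hc,
    circuitMatrix_adj c⟩

theorem realizes_ctrl (q t : Q) (h : q ≠ t) (V : Fin 2 → Matrix (Fin 2) (Fin 2) ℂ)
    (hV : ∀ b, V b ∈ unitaryGroup (Fin 2) ℂ) : Realizes (mux t fun y => V (y q)) 1 := by
  refine ⟨?_, [ctrlGate q t h V hV], by simp, by simp [circuitMatrix, ctrlGate_toMatrix]⟩
  rw [mem_unitaryGroup_iff', star_eq_conjTranspose, mux_conjTranspose, mux_mul, ← mux_one t]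
  congr 1
  funext y
  exact mem_unitaryGroup_iff'.1 (hV _)

end Mux

/-! ### Toffoli gates, and multiplexers restricted to invariant subspaces -/

section Toffoli

variable {Q : Type} [Fintype Q] [DecidableEq Q]

theorem pauliX_mem : pauliX ∈ unitaryGroup (Fin 2) ℂ := by
  rw [mem_unitaryGroup_iff']
  ext a b
  fin_cases a <;> fin_cases b <;> simp [pauliX, star_eq_conjTranspose, mul_apply]

/-- A square root of `X`. -/
def sqrtX : Matrix (Fin 2) (Fin 2) ℂ :=
  !![(1 + Complex.I) / 2, (1 - Complex.I) / 2; (1 - Complex.I) / 2, (1 + Complex.I) / 2]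

theorem sqrtX_mul_self : sqrtX * sqrtX = pauliX := by
  have h := Complex.I_mul_I
  ext a b
  fin_cases a <;> fin_cases b <;> simp [pauliX, sqrtX, mul_apply] <;>
    first | linear_combination (1/2) * h | linear_combination (-1/2) * h

theorem sqrtX_mem : sqrtX ∈ unitaryGroup (Fin 2) ℂ := by
  have h2 : (starRingEnd ℂ) 2 = 2 := Complex.conj_ofNat 2
  rw [mem_unitaryGroup_iff']
  ext a b
  fin_cases a <;> fin_cases b <;> simp [sqrtX, star_eq_conjTranspose, mul_apply, h2] <;>
    ring_nf <;> simp [Complex.I_sq] <;> ring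

theorem ite_mem_unitaryGroup {p : Prop} [Decidable p] {V W : Matrix (Fin 2) (Fin 2) ℂ}
    (hV : V ∈ unitaryGroup (Fin 2) ℂ) (hW : W ∈ unitaryGroup (Fin 2) ℂ) :
    (if p then V else W) ∈ unitaryGroup (Fin 2) ℂ := by
  split_ifs
  exacts [hV, hW]

/-- The Toffoli gate takes five two-qubit gates. -/
theorem realizes_toffoli {a b t : Q} (hab : a ≠ b) (hat : a ≠ t) (hbt : b ≠ t) (β : Fin 2) :
    Realizes (mux t fun y => if y a = 1 ∧ y b = β then pauliX else 1) 5 := by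
  have hW := sqrtX_mem
  have hW' : sqrtXᴴ ∈ unitaryGroup (Fin 2) ℂ := Unitary.star_mem hW
  have h1 : (1 : Matrix (Fin 2) (Fin 2) ℂ) ∈ unitaryGroup (Fin 2) ℂ := one_mem _
  have R1 := realizes_ctrl b t hbt (fun c => if c = β then sqrtX else 1)
    fun _ => ite_mem_unitaryGroup hW h1
  have R2 := realizes_ctrl b t hbt (fun c => if c = β then sqrtXᴴ else 1)
    fun _ => ite_mem_unitaryGroup hW' h1
  have R3 := realizes_ctrl a t hat (fun c => if c = 1 then sqrtX else 1)
    fun _ => ite_mem_unitaryGroup hW h1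
  have RC := realizes_ctrl a b hab (fun c => if c = 1 then pauliX else 1)
    fun _ => ite_mem_unitaryGroup pauliX_mem h1
  -- With `V = sqrtX`, conjugating the controlled `V†` by a controlled `X` tests the flipped bit `b`
  -- when `a = 1`. For `a = 0` the factors are `V V†` or trivial; for `a = 1` they are `V V = X` if
  -- `b = β` and `V† V = 1` otherwise.
  have R := (R1.mul ((RC.mul R2).mul RC)).mul R3
  have hconj := pauliX_conj_mux b t hbt (fun y => y a = 1)
    (fun y c d => by rw [Function.update_of_ne hat, Function.update_of_ne hab])
    (fun y => if y b = β then sqrtXᴴ else 1)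
  rw [hconj, mux_mul, mux_mul] at R
  convert R using 2
  funext y
  have e1 : sqrtXᴴ * sqrtX = 1 := mem_unitaryGroup_iff'.1 hW
  have e2 : sqrtX * sqrtXᴴ = 1 := mem_unitaryGroup_iff.1 hW
  have e3 : flipIf b (fun y => y a = 1) y b = if y a = 1 then 1 - y b else y b := by
    simp only [flipIf, Function.update_of_ne hab]
    split_ifs <;> simp
  rw [e3]
  have ha : y a = 0 ∨ y a = 1 := by omega
  have hb : 1 - y b = β ↔ ¬ y b = β := by
    exact (by decide : ∀ c β : Fin 2, 1 - c = β ↔ ¬ c = β) (y b) β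
  rcases ha with ha | ha
  · by_cases h : y b = β <;> simp [ha, h, e2]
  · by_cases h : y b = β
    · have h' : ¬ 1 - β = β := fun h' => hb.1 (h ▸ h') h
      simp [ha, h, h', sqrtX_mul_self]
    · simp [ha, h, hb.2 h, e1]

/-- Closure of the family `g` under changes of the bit `t` makes the span of its basis states
invariant, and `M` is the restriction to it. Gates on the whole register are turned into operators
on the data in this way. -/
theorem mux_mul_basisCols {ι : Type*} [Fintype ι] [DecidableEq ι] {g : ι → Q → Fin 2}
    (hg : Function.Injective g) (t : Q) (f : (Q → Fin 2) → Matrix (Fin 2) (Fin 2) ℂ)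
    (M : Matrix ι ι ℂ) (hclosed : ∀ j b, ∃ i, Function.update (g j) t b = g i)
    (hM : ∀ i j, mux t f (g i) (g j) = M i j) :
    mux t f * basisCols g = basisCols g * M := by
  ext x j
  rw [mul_basisCols]
  by_cases hx : ∃ i, x = g i
  · obtain ⟨i, rfl⟩ := hx
    rw [hM, mul_apply]
    simp [basisCols, hg.eq_iff]
  · have h1 : (basisCols g * M) x j = 0 := by
      rw [mul_apply]
      refine Finset.sum_eq_zero fun i _ => ?_
      simp only [basisCols, of_apply]
      rw [if_neg fun h => hx ⟨i, h⟩, zero_mul]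
    rw [h1, mux_apply, if_neg]
    intro h
    obtain ⟨i, hi⟩ := hclosed j (x t)
    refine hx ⟨i, ?_⟩
    rw [← hi]
    funext k
    by_cases hk : k = t
    · subst hk; simp
    · simp [hk, h k hk]

end Toffoli

/-! ### Exact implementation with ancillas -/

section Impl

variable {m w : ℕ}

/-- The state of the register when the work qubits hold a function of the data. -/
def regState (a : (Fin m → Fin 2) → Fin w → Fin 2) (p : Fin 2 × (Fin m → Fin 2)) :
    Qubits m w → Fin 2 :=
  Sum.elim p.2 (Sum.elim (fun _ => p.1) (a p.2))

theorem regState_injective (a : (Fin m → Fin 2) → Fin w → Fin 2) :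
    Function.Injective (regState a) := by
  intro p q h
  refine Prod.ext ?_ ?_
  · exact congrFun h (Sum.inr (Sum.inl ()))
  · funext k
    exact congrFun h (Sum.inl k)

/-- The isometry onto the states of the register in which the work qubits hold `a`. -/
abbrev regCols (a : (Fin m → Fin 2) → Fin w → Fin 2) :
    Matrix (Qubits m w → Fin 2) (Fin 2 × (Fin m → Fin 2)) ℂ :=
  basisCols (regState a)

variable (m w) in
/-- The isometry `ψ ↦ ψ ⊗ |0 … 0⟩` that adjoins the work qubits, on bit strings. -/
abbrev dataCols : Matrix (Qubits m w → Fin 2) (Fin 2 × (Fin m → Fin 2)) ℂ :=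
  regCols fun _ _ => 0

theorem mux_data_mul_basisCols (p : Fin m)
    (f : (Qubits m w → Fin 2) → Matrix (Fin 2) (Fin 2) ℂ)
    (h : (Fin m → Fin 2) → Matrix (Fin 2) (Fin 2) ℂ)
    (hf : ∀ c s, f (regState (fun _ _ => 0) (c, s)) = h s) :
    mux (Sum.inl p) f * dataCols m w
      = dataCols m w * ((1 : Matrix (Fin 2) (Fin 2) ℂ) ⊗ₖ mux p h) := by
  have hup : ∀ (c : Fin 2) (s : Fin m → Fin 2) b,
      Function.update (regState (fun _ (_ : Fin w) => 0) (c, s)) (Sum.inl p) b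
        = regState (fun _ _ => 0) (c, Function.update s p b) := by
    intro c s b
    funext k
    rcases k with k | k | k
    · by_cases hk : k = p
      · subst hk; simp [regState]
      · simp [regState, hk]
    · simp [regState]
    · simp [regState]
  refine mux_mul_basisCols (regState_injective _) _ _ _ (fun j b => ⟨_, hup j.1 j.2 b⟩) ?_
  rintro ⟨c', s'⟩ ⟨c, s⟩
  rw [mux_apply, kroneckerMap_apply, mux_apply, hup, hf]
  by_cases hc : c' = c
  · subst hc
    simp [regState]
  · simp [regState, hc]

/-- The work bits depend on the data but not on the dilation qubit, so a gate on that qubit stays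
among the states `regState a`. This permits acting while the work qubits still hold the comparison
results. -/
theorem mux_dilation_mul_basisCols (a : (Fin m → Fin 2) → Fin w → Fin 2)
    (f : (Qubits m w → Fin 2) → Matrix (Fin 2) (Fin 2) ℂ)
    (h : (Fin m → Fin 2) → Matrix (Fin 2) (Fin 2) ℂ)
    (hf : ∀ c s, f (regState a (c, s)) = h s) :
    mux (Sum.inr (Sum.inl ())) f * regCols a
      = regCols a * blockDiagonal h := by
  have hup : ∀ (c : Fin 2) (s : Fin m → Fin 2) b,
      Function.update (regState a (c, s)) (Sum.inr (Sum.inl ())) b = regState a (b, s) := by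
    intro c s b
    funext k
    rcases k with k | k | k <;> simp [regState]
  refine mux_mul_basisCols (regState_injective _) _ _ _ (fun j b => ⟨_, hup j.1 j.2 b⟩) ?_
  rintro ⟨c', s'⟩ ⟨c, s⟩
  rw [mux_apply, blockDiagonal_apply, hup, hf]
  by_cases hs : s' = s
  · subst hs
    simp [regState]
  · have : ¬ ∀ k, s' k = s k := fun h => hs (funext h)
    simp [regState, hs, this]

/-- `V` is implemented exactly by a circuit of at most `n` gates with `m + 1` work qubits that are
returned to `0`. -/
def Impl (V : Matrix (Fin 2 × (Fin m → Fin 2)) (Fin 2 × (Fin m → Fin 2)) ℂ) (n : ℕ) : Prop :=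
  ∃ C : Matrix (Qubits m (m + 1) → Fin 2) (Qubits m (m + 1) → Fin 2) ℂ, Realizes C n ∧
    C * dataCols m (m + 1) = dataCols m (m + 1) * V

variable {V W : Matrix (Fin 2 × (Fin m → Fin 2)) (Fin 2 × (Fin m → Fin 2)) ℂ}

theorem Impl.mono {a b : ℕ} (hV : Impl V a) (h : a ≤ b) : Impl V b := by
  obtain ⟨C, ⟨hC, c, hc, h1⟩, h2⟩ := hV
  exact ⟨C, ⟨hC, c, hc.trans h, h1⟩, h2⟩

theorem impl_one : Impl (1 : Matrix (Fin 2 × (Fin m → Fin 2)) (Fin 2 × (Fin m → Fin 2)) ℂ) 0 :=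
  ⟨1, ⟨one_mem _, [], le_rfl, rfl⟩, by simp⟩

theorem Impl.mul {a b : ℕ} (hV : Impl V a) (hW : Impl W b) : Impl (V * W) (a + b) := by
  obtain ⟨C, hC, hC'⟩ := hV
  obtain ⟨D, hD, hD'⟩ := hW
  exact ⟨C * D, hC.mul hD, by rw [Matrix.mul_assoc, hD', ← Matrix.mul_assoc, hC', Matrix.mul_assoc]⟩

/-- With `J` the isometry adjoining the work qubits, `C J = J V` and the unitarity of `C` give `V† V
= (J V)† (J V) = J† J`. Unitarity of everything built from gates thus comes for free. -/
theorem Impl.conjTranspose_mul_self {a : ℕ} (hV : Impl V a) : Vᴴ * V = 1 := by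
  obtain ⟨C, hC, hC'⟩ := hV
  have hJ := basisCols_isometry (regState_injective fun (_ : Fin m → Fin 2) (_ : Fin (m + 1)) => 0)
  have h := congrArg (fun X => Xᴴ * X) hC'
  simp only [conjTranspose_mul] at h
  rw [Matrix.mul_assoc, ← Matrix.mul_assoc _ C, hC.conjTranspose_mul_self, Matrix.one_mul, hJ,
    Matrix.mul_assoc, ← Matrix.mul_assoc _ _ V, hJ, Matrix.one_mul] at h
  exact h.symm

theorem Impl.adj {a : ℕ} (hV : Impl V a) : Impl Vᴴ a := by
  have hVV := mul_eq_one_comm.1 hV.conjTranspose_mul_self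
  obtain ⟨C, hC, hC'⟩ := hV
  refine ⟨Cᴴ, hC.adj, ?_⟩
  calc Cᴴ * dataCols m (m + 1) = Cᴴ * (dataCols m (m + 1) * V * Vᴴ) := by
        rw [Matrix.mul_assoc, hVV, Matrix.mul_one]
    _ = dataCols m (m + 1) * Vᴴ := by
        rw [← hC', ← Matrix.mul_assoc, ← Matrix.mul_assoc, hC.conjTranspose_mul_self,
          Matrix.one_mul]

/-- A gate on two data qubits. -/
theorem impl_data_ctrl {q p : Fin m} (h : q ≠ p) (V : Fin 2 → Matrix (Fin 2) (Fin 2) ℂ)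
    (hV : ∀ b, V b ∈ unitaryGroup (Fin 2) ℂ) :
    Impl ((1 : Matrix (Fin 2) (Fin 2) ℂ) ⊗ₖ mux p fun y => V (y q)) 1 :=
  ⟨_, realizes_ctrl (Sum.inl q) (Sum.inl p) (by simpa using h) V hV,
    mux_data_mul_basisCols p _ _ fun _ _ => rfl⟩

/-- A gate on one data qubit. -/
theorem impl_data (p : Fin m) {V : Matrix (Fin 2) (Fin 2) ℂ} (hV : V ∈ unitaryGroup (Fin 2) ℂ) :
    Impl ((1 : Matrix (Fin 2) (Fin 2) ℂ) ⊗ₖ mux p fun _ => V) 1 :=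
  ⟨_, realizes_ctrl (Sum.inr (Sum.inl ())) (Sum.inl p) (by simp) (fun _ => V) fun _ => hV,
    mux_data_mul_basisCols p _ _ fun _ _ => rfl⟩

/-- A gate on the dilation qubit. -/
theorem impl_dilation {V : Matrix (Fin 2) (Fin 2) ℂ} (hV : V ∈ unitaryGroup (Fin 2) ℂ) :
    Impl (blockDiagonal fun _ : Fin m → Fin 2 => V) 1 :=
  ⟨_, realizes_ctrl (Sum.inr (Sum.inr 0)) (Sum.inr (Sum.inl ())) (by simp) (fun _ => V)
    fun _ => hV, mux_dilation_mul_basisCols _ _ _ fun _ _ => rfl⟩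

/-- The work qubit `j ≤ i` holds whether `s` and `u` agree on the first `j` positions. -/
def prefixBits (u : Fin m → Fin 2) (i : ℕ) (s : Fin m → Fin 2) (j : Fin (m + 1)) : Fin 2 :=
  if (j : ℕ) ≤ i ∧ ∀ p : Fin m, (p : ℕ) < j → s p = u p then 1 else 0

/-- Lets the ladder be verified one work qubit at a time. -/
theorem flipIf_work (a : (Fin m → Fin 2) → Fin (m + 1) → Fin 2) (j : Fin (m + 1))
    (P : (Qubits m (m + 1) → Fin 2) → Prop) [DecidablePred P] (c : Fin 2) (s : Fin m → Fin 2)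
    (b : Fin (m + 1) → Fin 2) (hb : ∀ i, i ≠ j → b i = a s i)
    (hP : b j = if P (Function.update (regState a (c, s)) (Sum.inr (Sum.inr j)) 0)
      then 1 - a s j else a s j) :
    flipIf (Sum.inr (Sum.inr j)) P (regState a (c, s)) = Sum.elim s (Sum.elim (fun _ => c) b) := by
  simp only [flipIf]
  split_ifs at hP ⊢ with h
  · funext k
    rcases k with k | k | k
    · simp [regState]
    · simp [regState]
    · by_cases hk : k = j
      · subst hk; simp [regState, hP]
      · simp [regState, hk, hb k hk]
  · funext k
    rcases k with k | k | k
    · simp [regState]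
    · simp [regState]
    · by_cases hk : k = j
      · subst hk; simp [regState, hP]
      · simp [regState, hb k hk]

/-- A ladder of Toffoli gates compares the data with `u`. -/
theorem exists_ladder (u : Fin m → Fin 2) (i : ℕ) (hi : i ≤ m) :
    ∃ C : Matrix (Qubits m (m + 1) → Fin 2) (Qubits m (m + 1) → Fin 2) ℂ,
      Realizes C (1 + 5 * i) ∧
      C * dataCols m (m + 1) = regCols (prefixBits u i) := by
  induction i with
  | zero =>
    -- The empty prefix always agrees, so work qubit `0` is set unconditionally; the dilation qubit
    -- serves as an idle control.
    refine ⟨_, realizes_ctrl (Sum.inr (Sum.inl ())) (Sum.inr (Sum.inr 0)) (by simp)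
      (fun _ => pauliX) fun _ => pauliX_mem, ?_⟩
    have h := mux_pauliX_mul_basisCols (Q := Qubits m (m + 1)) (Sum.inr (Sum.inr 0))
      (fun _ => True) (regState fun _ _ => 0)
    simp only [if_true] at h
    rw [h]
    congr 1
    funext ⟨c, s⟩
    refine flipIf_work _ _ _ c s _ ?_ ?_
    · intro k hk
      have : ¬ ((k : ℕ) ≤ 0) := fun h => hk (Fin.ext (by simpa using h))
      simp [prefixBits, this]
    · simp [prefixBits]
  | succ i ih =>
    obtain ⟨C, hC, hC'⟩ := ih (by omega)
    have hT := realizes_toffoli (Q := Qubits m (m + 1)) (a := Sum.inr (Sum.inr ⟨i, by omega⟩))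
      (b := Sum.inl ⟨i, by omega⟩) (t := Sum.inr (Sum.inr ⟨i + 1, by omega⟩)) (by simp)
      (by simp) (by simp) (u ⟨i, by omega⟩)
    have hR := hT.mul hC
    rw [show 5 + (1 + 5 * i) = 1 + 5 * (i + 1) by ring] at hR
    refine ⟨_, hR, ?_⟩
    rw [Matrix.mul_assoc, hC']
    have h := mux_pauliX_mul_basisCols (Q := Qubits m (m + 1))
      (Sum.inr (Sum.inr ⟨i + 1, by omega⟩))
      (fun y => y (Sum.inr (Sum.inr ⟨i, by omega⟩)) = 1 ∧ y (Sum.inl ⟨i, by omega⟩) =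
        u ⟨i, by omega⟩) (regState (prefixBits u i))
    rw [h]
    congr 1
    funext ⟨c, s⟩
    refine flipIf_work _ _ _ c s _ ?_ ?_
    · intro k hk
      have : (k : ℕ) ≤ i + 1 ↔ (k : ℕ) ≤ i := by
        have : (k : ℕ) ≠ i + 1 := fun h => hk (Fin.ext h)
        omega
      simp [prefixBits, this]
    · have key : (∀ p : Fin m, (p : ℕ) ≤ i → s p = u p) ↔
          (∀ p : Fin m, (p : ℕ) < i → s p = u p) ∧ s ⟨i, by omega⟩ = u ⟨i, by omega⟩ := by
        constructor
        · intro h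
          exact ⟨fun p hp => h p (by omega), h _ (by simp)⟩
        · rintro ⟨h1, h2⟩ p hp
          by_cases hpi : (p : ℕ) = i
          · have : p = ⟨i, by omega⟩ := Fin.ext hpi
            rw [this, h2]
          · exact h1 p (by omega)
      simp [prefixBits, regState, key]

/-- A one-qubit gate on the dilation qubit, controlled by the first `n` data qubits. -/
theorem impl_prefix_ctrl (u : Fin m → Fin 2) {n : ℕ} (hn : n ≤ m)
    {W : Matrix (Fin 2) (Fin 2) ℂ} (hW : W ∈ unitaryGroup (Fin 2) ℂ) :
    Impl (blockDiagonal fun s : Fin m → Fin 2 =>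
      if ∀ p : Fin m, (p : ℕ) < n → s p = u p then W else 1) (3 + 10 * n) := by
  obtain ⟨C, hC, hC'⟩ := exists_ladder u n hn
  have hW' := realizes_ctrl (Q := Qubits m (m + 1)) (Sum.inr (Sum.inr ⟨n, by omega⟩))
    (Sum.inr (Sum.inl ())) (by simp) (fun b => if b = 1 then W else 1)
    fun _ => ite_mem_unitaryGroup hW (one_mem _)
  -- Compute, act, uncompute: `W` changes only the dilation qubit, so the inverse ladder still
  -- clears all work qubits.
  have hR := (hC.adj.mul hW').mul hC
  rw [show 1 + 5 * n + 1 + (1 + 5 * n) = 3 + 10 * n by ring] at hR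
  refine ⟨_, hR, ?_⟩
  rw [Matrix.mul_assoc, hC', Matrix.mul_assoc, mux_dilation_mul_basisCols (prefixBits u n) _
    (fun s => if ∀ p : Fin m, (p : ℕ) < n → s p = u p then W else 1), ← hC', ← Matrix.mul_assoc,
    ← Matrix.mul_assoc, hC.conjTranspose_mul_self, Matrix.one_mul]
  intro c s
  simp [regState, prefixBits]

end Impl

open scoped Matrix.Norms.L2Operator

/-! ### The approximate quantum Fourier transform -/

section Fourier

variable {m : ℕ}

theorem mux_diagonal {Q : Type} [Fintype Q] [DecidableEq Q] (t : Q)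
    (g : Fin 2 → (Q → Fin 2) → ℂ) (hg : ∀ a s b, g a (Function.update s t b) = g a s) :
    mux t (fun y => diagonal fun a => g a y) = diagonal fun s => g (s t) s := by
  ext x y
  rw [mux_apply]
  by_cases h : x = y
  · subst h; simp [hg]
  · rw [diagonal_apply_ne _ h]
    split_ifs with h'
    · rw [diagonal_apply_ne]
      intro ht
      exact h (funext fun k => by by_cases hk : k = t; exacts [hk ▸ ht, h' k hk])
    · rfl

theorem diagonal_phase_mem {ι : Type*} [Fintype ι] [DecidableEq ι] (θ : ι → ℝ) :
    diagonal (fun i => Complex.exp ((θ i : ℂ) * Complex.I)) ∈ unitaryGroup ι ℂ := by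
  rw [mem_unitaryGroup_iff', star_eq_conjTranspose, diagonal_conjTranspose, diagonal_mul_diagonal,
    ← diagonal_one]
  congr 1
  funext i
  simp only [Pi.star_apply, RCLike.star_def, ← Complex.exp_conj, ← Complex.exp_add]
  simp

/-- The Hadamard gate. -/
def hadamard : Matrix (Fin 2) (Fin 2) ℂ :=
  of fun a b => ((Real.sqrt 2 : ℝ) : ℂ)⁻¹ * Complex.exp ((-(Real.pi * a * b) : ℝ) * Complex.I)

theorem hadamard_mem : hadamard ∈ unitaryGroup (Fin 2) ℂ := by
  have h2 : ((Real.sqrt 2 : ℝ) : ℂ)⁻¹ * ((Real.sqrt 2 : ℝ) : ℂ)⁻¹ = 1 / 2 := by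
    rw [← mul_inv, ← Complex.ofReal_mul, Real.mul_self_sqrt (by norm_num)]; norm_num
  have h3 : Complex.exp (-(Real.pi * Complex.I)) = -1 := by
    rw [Complex.exp_neg, Complex.exp_pi_mul_I]; norm_num
  rw [mem_unitaryGroup_iff']
  ext a b
  fin_cases a <;> fin_cases b <;>
    simp [hadamard, star_eq_conjTranspose, mul_apply, h3] <;>
    linear_combination 2 * h2

/-- The rotation angle in step `p` of the Fourier transform, with controls in `T`. -/
def stepAngle (T : Finset (Fin m)) (p : Fin m) (s : Fin m → Fin 2) : ℝ :=
  ∑ q ∈ T, Real.pi * s p * s q / 2 ^ ((p : ℕ) - q)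

/-- The angle is a sum over the controls, so the diagonal operator factors into one controlled phase
per control. -/
theorem impl_controlled_phases (p : Fin m) (T : Finset (Fin m)) (hT : p ∉ T) :
    Impl ((1 : Matrix (Fin 2) (Fin 2) ℂ) ⊗ₖ
      diagonal fun s => Complex.exp ((-stepAngle T p s : ℝ) * Complex.I)) T.card := by
  induction T using Finset.induction_on with
  | empty => simpa [stepAngle] using impl_one
  | insert q T hq ih =>
    have hqp : q ≠ p := fun h => hT (by simp [h])
    rw [Finset.card_insert_of_notMem hq]
    have h1 := (ih fun h => hT (Finset.mem_insert_of_mem h)).mul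
      (impl_data_ctrl hqp (fun b => diagonal fun a : Fin 2 =>
        Complex.exp ((-(Real.pi * a * b / 2 ^ ((p : ℕ) - q)) : ℝ) * Complex.I))
        fun b => diagonal_phase_mem _)
    rw [mux_diagonal p (fun a s => Complex.exp
      ((-(Real.pi * a * s q / 2 ^ ((p : ℕ) - q)) : ℝ) * Complex.I))
      (fun a s b => by rw [Function.update_of_ne hqp]), ← mul_kronecker_mul,
      diagonal_mul_diagonal, Matrix.one_mul] at h1
    have e : (fun s => Complex.exp ((-stepAngle (insert q T) p s : ℝ) * Complex.I))
        = fun s => Complex.exp ((-stepAngle T p s : ℝ) * Complex.I) *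
          Complex.exp ((-(Real.pi * s p * s q / 2 ^ ((p : ℕ) - q)) : ℝ) * Complex.I) := by
      funext s
      rw [← Complex.exp_add, stepAngle, Finset.sum_insert hq]
      congr 1
      simp only [stepAngle]
      push_cast
      ring
    rw [e]
    exact h1

/-- The controls of the step `p` of the Fourier transform, cut off at distance `t`. -/
def controls (t : ℕ) (p : Fin m) : Finset (Fin m) :=
  Finset.univ.filter fun q => q < p ∧ (p : ℕ) - q ≤ t

/-- Distinct controls lie at distinct distances in `[1, t]`. -/
theorem card_controls_le (t : ℕ) (p : Fin m) : (controls t p).card ≤ t := by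
  have h : (controls t p).card ≤ (Finset.Icc 1 t).card := by
    refine Finset.card_le_card_of_injOn (fun q => (p : ℕ) - q) ?_ ?_
    · intro q hq
      simp only [controls, Finset.coe_filter, Finset.mem_univ, true_and, Set.mem_ofPred_eq] at hq
      have := Fin.lt_def.1 hq.1
      simp only [Finset.coe_Icc, Set.mem_Icc]
      omega
    · intro q hq q' hq' h
      simp only [controls, Finset.coe_filter, Finset.mem_univ, true_and, Set.mem_ofPred_eq] at hq hq'
      have h1 := Fin.lt_def.1 hq.1
      have h2 := Fin.lt_def.1 hq'.1
      simp only at h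
      exact Fin.ext (by omega)
  simpa using h

/-- The step `p` of the Fourier transform, with phases cut off at distance `t`. -/
def qftStep (t : ℕ) (p : Fin m) : Matrix (Fin m → Fin 2) (Fin m → Fin 2) ℂ :=
  diagonal (fun s => Complex.exp ((-stepAngle (controls t p) p s : ℝ) * Complex.I)) *
    mux p fun _ => hadamard

variable (m) in
/-- The approximate quantum Fourier transform on the first `n` qubits, without the reversal of the
bits. It is exact if `m ≤ t`. -/
def qft (t : ℕ) : ℕ → Matrix (Fin m → Fin 2) (Fin m → Fin 2) ℂ
  | 0 => 1
  | n + 1 => qft t n * if h : n < m then qftStep t ⟨n, h⟩ else 1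

theorem impl_qftStep (t : ℕ) (p : Fin m) :
    Impl ((1 : Matrix (Fin 2) (Fin 2) ℂ) ⊗ₖ qftStep t p) (t + 1) := by
  have h1 : Impl ((1 : Matrix (Fin 2) (Fin 2) ℂ) ⊗ₖ
      diagonal fun s => Complex.exp ((-stepAngle (controls t p) p s : ℝ) * Complex.I)) t :=
    (impl_controlled_phases p _ (by simp [controls])).mono (card_controls_le t p)
  have h2 := h1.mul (impl_data p hadamard_mem)
  rwa [← mul_kronecker_mul, Matrix.one_mul] at h2

theorem impl_qft (t n : ℕ) :
    Impl ((1 : Matrix (Fin 2) (Fin 2) ℂ) ⊗ₖ qft m t n) (n * (t + 1)) := by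
  induction n with
  | zero => simpa [qft] using impl_one
  | succ n ih =>
    rw [qft, add_mul, one_mul]
    by_cases h : n < m
    · have := ih.mul (impl_qftStep t ⟨n, h⟩)
      rw [← mul_kronecker_mul, Matrix.one_mul] at this
      simpa [h] using this
    · simpa [h] using ih.mono (by omega)

theorem norm_le_one_of_isometry {ι κ : Type*} [Fintype ι] [Fintype κ] [DecidableEq ι]
    [DecidableEq κ] {A : Matrix ι κ ℂ} (h : Aᴴ * A = 1) : ‖A‖ ≤ 1 := by
  have h1 := l2_opNorm_conjTranspose_mul_self A
  rw [h, ← diagonal_one, l2_opNorm_diagonal] at h1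
  have h2 : ‖(fun _ : κ => (1 : ℂ))‖ ≤ 1 := (pi_norm_le_iff_of_nonneg zero_le_one).2 (by simp)
  nlinarith [norm_nonneg A]

theorem norm_exp_sub_exp_le (x y : ℝ) :
    ‖Complex.exp (x * Complex.I) - Complex.exp (y * Complex.I)‖ ≤ |x - y| := by
  have h : Complex.exp (x * Complex.I) - Complex.exp (y * Complex.I)
      = Complex.exp (y * Complex.I) * (Complex.exp (Complex.I * ((x - y : ℝ) : ℂ)) - 1) := by
    rw [mul_sub, ← Complex.exp_add, mul_one]
    congr 2
    push_cast
    ring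
  rw [h, norm_mul, Complex.norm_exp_ofReal_mul_I, one_mul]
  exact Real.norm_exp_I_mul_ofReal_sub_one_le

/-- The omitted angles are at most `π / 2^d` for distinct distances `d > t`: the tail of a geometric
series. -/
theorem abs_stepAngle_sub_le (t : ℕ) (p : Fin m) (s : Fin m → Fin 2) :
    |stepAngle (controls t p) p s - stepAngle (controls m p) p s| ≤ Real.pi / 2 ^ t := by
  have hsub : controls t p ∩ controls m p = controls t p := by
    refine Finset.inter_eq_left.2 fun q hq => ?_
    simp only [controls, Finset.mem_filter, Finset.mem_univ, true_and] at hq ⊢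
    exact ⟨hq.1, by omega⟩
  have hsub' : controls t p ⊆ controls m p := Finset.inter_eq_left.1 hsub
  rw [abs_sub_comm, stepAngle, stepAngle, ← Finset.sum_sdiff hsub', add_sub_cancel_right,
    abs_of_nonneg (Finset.sum_nonneg fun q _ => by positivity)]
  have hb : ∀ b : Fin 2, ((b : ℕ) : ℝ) ≤ 1 := fun b => by
    exact_mod_cast Nat.le_of_lt_succ b.2
  calc ∑ q ∈ controls m p \ controls t p, Real.pi * s p * s q / 2 ^ ((p : ℕ) - q)
      ≤ ∑ q ∈ controls m p \ controls t p, Real.pi * (1 / 2) ^ ((p : ℕ) - q) := by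
        refine Finset.sum_le_sum fun q _ => ?_
        rw [one_div, inv_pow, ← div_eq_mul_inv]
        gcongr
        calc Real.pi * s p * s q ≤ Real.pi * 1 * 1 := by
              gcongr
              exacts [hb _, hb _]
          _ = Real.pi := by ring
    _ = Real.pi * ∑ d ∈ (controls m p \ controls t p).image (fun q : Fin m => (p : ℕ) - q),
          (1 / 2 : ℝ) ^ d := by
        rw [Finset.sum_image, Finset.mul_sum]
        intro q hq q' hq' h
        simp only [controls, Finset.coe_sdiff, Finset.coe_filter, Finset.mem_univ, true_and,
          Set.mem_sdiff, Set.mem_ofPred_eq] at hq hq'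
        have h1 := Fin.lt_def.1 hq.1.1
        have h2 := Fin.lt_def.1 hq'.1.1
        simp only at h
        exact Fin.ext (by omega)
    -- The upper end only has to exceed every distance that occurs.
    _ ≤ Real.pi * ∑ d ∈ Finset.Ico (t + 1) (m + t + 2), (1 / 2 : ℝ) ^ d := by
        gcongr
        intro d hd
        simp only [controls, Finset.mem_image, Finset.mem_sdiff, Finset.mem_filter,
          Finset.mem_univ, true_and, not_and, not_le] at hd
        obtain ⟨q, ⟨⟨h1, h2⟩, h3⟩, rfl⟩ := hd
        have := h3 h1
        simp only [Finset.mem_Ico]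
        omega
    _ ≤ Real.pi * ((1 / 2) ^ (t + 1) / (1 - 1 / 2)) := by
        gcongr
        exact geom_sum_Ico_le_of_lt_one (by norm_num) (by norm_num)
    _ = Real.pi / 2 ^ t := by
        rw [pow_succ, one_div, inv_pow]; ring

theorem norm_kronecker_diagonal_le {d : (Fin m → Fin 2) → ℂ} {B : ℝ} (hB : 0 ≤ B)
    (h : ∀ s, ‖d s‖ ≤ B) : ‖(1 : Matrix (Fin 2) (Fin 2) ℂ) ⊗ₖ diagonal d‖ ≤ B := by
  rw [← diagonal_one, diagonal_kronecker_diagonal, l2_opNorm_diagonal]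
  exact (pi_norm_le_iff_of_nonneg hB).2 fun p => by simpa using h p.2

theorem norm_qftStep_sub_le (t : ℕ) (p : Fin m) :
    ‖(1 : Matrix (Fin 2) (Fin 2) ℂ) ⊗ₖ qftStep t p - 1 ⊗ₖ qftStep m p‖ ≤ Real.pi / 2 ^ t := by
  have h : (1 : Matrix (Fin 2) (Fin 2) ℂ) ⊗ₖ qftStep t p - 1 ⊗ₖ qftStep m p
      = ((1 : Matrix (Fin 2) (Fin 2) ℂ) ⊗ₖ diagonal fun s =>
          Complex.exp ((-stepAngle (controls t p) p s : ℝ) * Complex.I) -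
          Complex.exp ((-stepAngle (controls m p) p s : ℝ) * Complex.I)) *
        ((1 : Matrix (Fin 2) (Fin 2) ℂ) ⊗ₖ mux p fun _ => hadamard) := by
    rw [← mul_kronecker_mul, Matrix.one_mul, ← diagonal_sub, Matrix.sub_mul]
    ext a b
    simp only [qftStep, kroneckerMap_apply, Matrix.sub_apply, mul_sub]
  rw [h]
  refine (l2_opNorm_mul _ _).trans ?_
  have h1 := norm_le_one_of_isometry (impl_data p hadamard_mem).conjTranspose_mul_self
  have h2 : ‖(1 : Matrix (Fin 2) (Fin 2) ℂ) ⊗ₖ diagonal fun s =>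
          Complex.exp ((-stepAngle (controls t p) p s : ℝ) * Complex.I) -
          Complex.exp ((-stepAngle (controls m p) p s : ℝ) * Complex.I)‖ ≤ Real.pi / 2 ^ t := by
    refine norm_kronecker_diagonal_le (by positivity) fun s => ?_
    refine (norm_exp_sub_exp_le _ _).trans ?_
    rw [neg_sub_neg, abs_sub_comm]
    exact abs_stepAngle_sub_le t p s
  calc _ ≤ Real.pi / 2 ^ t * 1 := by gcongr
    _ = _ := mul_one _

/-- Errors of products of unitaries add: the difference telescopes, and all other factors have norm
at most one. -/
theorem norm_qft_sub_le (t n : ℕ) :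
    ‖(1 : Matrix (Fin 2) (Fin 2) ℂ) ⊗ₖ qft m t n - 1 ⊗ₖ qft m m n‖ ≤ n * (Real.pi / 2 ^ t) := by
  induction n with
  | zero => simp [qft]
  | succ n ih =>
    by_cases h : n < m
    · set X := (1 : Matrix (Fin 2) (Fin 2) ℂ) ⊗ₖ qft m t n with hX
      set Y := (1 : Matrix (Fin 2) (Fin 2) ℂ) ⊗ₖ qft m m n with hY
      set S := (1 : Matrix (Fin 2) (Fin 2) ℂ) ⊗ₖ qftStep t ⟨n, h⟩ with hS
      set R := (1 : Matrix (Fin 2) (Fin 2) ℂ) ⊗ₖ qftStep m ⟨n, h⟩ with hR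
      have e1 : (1 : Matrix (Fin 2) (Fin 2) ℂ) ⊗ₖ qft m t (n + 1) = X * S := by
        rw [hX, hS, ← mul_kronecker_mul, Matrix.one_mul]; simp [qft, h]
      have e2 : (1 : Matrix (Fin 2) (Fin 2) ℂ) ⊗ₖ qft m m (n + 1) = Y * R := by
        rw [hY, hR, ← mul_kronecker_mul, Matrix.one_mul]; simp [qft, h]
      have e3 : X * S - Y * R = (X - Y) * S + Y * (S - R) := by
        rw [Matrix.sub_mul, Matrix.mul_sub]; abel
      rw [e1, e2, e3]
      have nS : ‖S‖ ≤ 1 := norm_le_one_of_isometry (impl_qftStep t ⟨n, h⟩).conjTranspose_mul_self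
      have nY : ‖Y‖ ≤ 1 := norm_le_one_of_isometry (impl_qft m n).conjTranspose_mul_self
      have nSR := norm_qftStep_sub_le t (⟨n, h⟩ : Fin m)
      calc ‖(X - Y) * S + Y * (S - R)‖ ≤ ‖X - Y‖ * ‖S‖ + ‖Y‖ * ‖S - R‖ :=
            (norm_add_le _ _).trans (add_le_add (l2_opNorm_mul _ _) (l2_opNorm_mul _ _))
        _ ≤ n * (Real.pi / 2 ^ t) * 1 + 1 * (Real.pi / 2 ^ t) := by gcongr
        _ = _ := by push_cast; ring
    · simp only [qft, dif_neg h, Matrix.mul_one]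
      refine ih.trans ?_
      gcongr
      simp

/-- The matrix entries of the exact Fourier transform. -/
theorem qft_apply (n : ℕ) (hn : n ≤ m) (x y : Fin m → Fin 2) :
    qft m m n x y = if ∀ k : Fin m, n ≤ k → x k = y k then
      ((Real.sqrt 2 : ℝ) : ℂ)⁻¹ ^ n * Complex.exp ((-∑ p ∈ Finset.univ.filter fun p : Fin m => p < n,
        ∑ q ∈ Finset.univ.filter (· ≤ p), Real.pi * x p * y q / 2 ^ ((p : ℕ) - q) : ℝ) * Complex.I)
      else 0 := by
  induction n generalizing x y with
  | zero => simp [qft, one_apply, funext_iff]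
  | succ n ih =>
    have h : n < m := hn
    set i : Fin m := ⟨n, h⟩ with hi
    -- Step `i` changes only the bit `i`, and the other factor fixes all bits from `n` on, so a
    -- single intermediate string contributes.
    rw [qft, dif_pos h, mul_apply, Finset.sum_eq_single (Function.update y i (x i))]
    · rw [ih h.le, qftStep, diagonal_mul, mux_apply, if_pos (fun k hk => Function.update_of_ne hk _ _)]
      have hcond : (∀ k : Fin m, n ≤ k → x k = Function.update y i (x i) k) ↔
          ∀ k : Fin m, n + 1 ≤ k → x k = y k := by
        constructor
        · intro h1 k hk
          have := h1 k (by omega)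
          rwa [Function.update_of_ne (fun h => by rw [h, hi] at hk; simp at hk)] at this
        · intro h1 k hk
          by_cases hki : k = i
          · subst hki; simp
          · rw [Function.update_of_ne hki]
            exact h1 k (lt_of_le_of_ne hk fun h => hki (Fin.ext h.symm))
      rw [← hi]
      rw [ite_mul, zero_mul, Function.update_self]
      refine if_congr hcond ?_ rfl
      have hf : (Finset.univ.filter fun p : Fin m => (p : ℕ) < n + 1)
          = insert i (Finset.univ.filter fun p : Fin m => (p : ℕ) < n) := by
        ext p
        simp only [Finset.mem_filter, Finset.mem_univ, true_and, Finset.mem_insert, hi, Fin.ext_iff]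
        omega
      -- The term `q = i` of the phase is the sign of the Hadamard entry; the terms `q < i` come
      -- from the controlled phases, none of which is cut off at distance `m`.
      have hg : (Finset.univ.filter fun q : Fin m => q ≤ i) = insert i (controls m i) := by
        ext q
        simp only [Finset.mem_filter, Finset.mem_univ, true_and, Finset.mem_insert, controls,
          Fin.ext_iff, Fin.le_def, Fin.lt_def]
        omega
      rw [hf, Finset.sum_insert (by simp [hi]), hg, Finset.sum_insert (by simp [controls])]
      have e1 : ∑ p ∈ Finset.univ.filter (fun p : Fin m => (p : ℕ) < n),
          ∑ q ∈ Finset.univ.filter (· ≤ p),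
            Real.pi * x p * Function.update y i (x i) q / 2 ^ ((p : ℕ) - q)
          = ∑ p ∈ Finset.univ.filter (fun p : Fin m => (p : ℕ) < n),
          ∑ q ∈ Finset.univ.filter (· ≤ p), Real.pi * x p * y q / 2 ^ ((p : ℕ) - q) := by
        refine Finset.sum_congr rfl fun p hp => Finset.sum_congr rfl fun q hq => ?_
        simp only [Finset.mem_filter, Finset.mem_univ, true_and, Fin.le_def] at hp hq
        rw [Function.update_of_ne fun h => by rw [h, hi] at hq; simp at hq; omega]
      have e2 : stepAngle (controls m i) i (Function.update y i (x i))
          = ∑ q ∈ controls m i, Real.pi * x i * y q / 2 ^ ((i : ℕ) - q) := by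
        refine Finset.sum_congr rfl fun q hq => ?_
        simp only [controls, Finset.mem_filter, Finset.mem_univ, true_and] at hq
        rw [Function.update_of_ne hq.1.ne, Function.update_self]
      rw [e1, e2, hadamard, of_apply]
      rw [pow_succ]
      set a := ((Real.sqrt 2 : ℝ) : ℂ)⁻¹
      have e3 : ∀ u v w : ℂ, a ^ n * u * (v * (a * w)) = a ^ n * a * (u * v * w) := by
        intros; ring
      rw [e3, ← Complex.exp_add, ← Complex.exp_add]
      congr 2
      push_cast
      simp only [Nat.sub_self, pow_zero, div_one]
      ring
    · intro z _ hz
      rw [ih h.le, qftStep, diagonal_mul, mux_apply]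
      split_ifs with h1 h2
      · exfalso
        refine hz (funext fun k => ?_)
        by_cases hk : k = i
        · subst hk
          simpa using (h1 _ (by simp [hi])).symm
        · simpa [hk] using h2 k hk
      all_goals simp
    · simp

theorem qft_isometry (t n : ℕ) : (qft m t n)ᴴ * qft m t n = 1 := by
  have h := (impl_qft (m := m) t n).conjTranspose_mul_self
  rw [conjTranspose_kronecker, ← mul_kronecker_mul, conjTranspose_one, Matrix.one_mul] at h
  ext x y
  have h1 := congrFun (congrFun h (0, x)) (0, y)
  rw [kroneckerMap_apply, one_apply_eq, one_mul] at h1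
  rw [h1]
  simp [one_apply]

end Fourier

/-! ### The Fourier matrix on bit strings -/

section FourierBits

variable {m : ℕ}

variable (m) in
/-- The bits of `l`, most significant bit first, with the most significant bit flipped: the two's
complement of `l - 2 ^ m / 2`. -/
def freqBits : Fin (2 ^ m) ≃ (Fin m → Fin 2) :=
  (finFunctionFinEquiv.symm.trans (Equiv.arrowCongr Fin.revPerm (Equiv.refl _))).trans
    (Equiv.piCongrRight fun p => if (p : ℕ) = 0 then Equiv.swap 0 1 else Equiv.refl _)

theorem freqBits_apply (l : Fin (2 ^ m)) (p : Fin m) :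
    freqBits m l p = if (p : ℕ) = 0 then 1 - finFunctionFinEquiv.symm l p.rev
      else finFunctionFinEquiv.symm l p.rev := by
  have h : ∀ a : Fin 2, Equiv.swap (0 : Fin 2) 1 a = 1 - a := by decide
  simp only [freqBits, Equiv.trans_apply, Equiv.piCongrRight_apply, Pi.map_apply]
  split_ifs
  · rw [h]; rfl
  · rfl

/-- The contribution of a bit to the wave number. -/
def waveCoef (p : Fin m) : ℝ := if (p : ℕ) = 0 then -2 ^ (m - 1) else 2 ^ (m - 1 - p)

/-- The wave number of a bit string in two's complement. -/
def waveNumber (s : Fin m → Fin 2) : ℝ := ∑ p, waveCoef p * s p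

/-- For the leading bit, `-2^(m-1) (1 - b) = 2^(m-1) b - 2^(m-1)`: the flip accounts for the shift
by half the number of grid points. -/
theorem waveNumber_freqBits (hm : 1 ≤ m) (l : Fin (2 ^ m)) :
    waveNumber (freqBits m l) = (l : ℝ) - 2 ^ m / 2 := by
  set f := (finFunctionFinEquiv (m := 2) (n := m)).symm l with hf
  have hl : (l : ℝ) = ∑ p : Fin m, (f p.rev : ℝ) * 2 ^ (m - 1 - (p : ℕ)) := by
    have h1 : (l : ℕ) = ∑ i : Fin m, (f i : ℕ) * 2 ^ (i : ℕ) := by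
      rw [← finFunctionFinEquiv_apply, hf, Equiv.apply_symm_apply]
    rw [h1, ← Equiv.sum_comp Fin.revPerm]
    push_cast
    refine Finset.sum_congr rfl fun p _ => ?_
    rw [Fin.revPerm_apply, Fin.val_rev, show m - ((p : ℕ) + 1) = m - 1 - p by omega]
  have hp : (2 : ℝ) ^ m / 2 = 2 ^ (m - 1) := by
    obtain ⟨n, rfl⟩ : ∃ n, m = n + 1 := ⟨m - 1, by omega⟩
    rw [pow_succ]; simp
  have h0 : (2 : ℝ) ^ m / 2 = ∑ p : Fin m, if (p : ℕ) = 0 then (2 : ℝ) ^ (m - 1) else 0 := by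
    rw [hp, Finset.sum_eq_single (⟨0, hm⟩ : Fin m)]
    · simp
    · intro p _ hp
      rw [if_neg fun h => hp (Fin.ext h)]
    · simp
  rw [hl, h0, ← Finset.sum_sub_distrib, waveNumber]
  refine Finset.sum_congr rfl fun p _ => ?_
  rw [freqBits_apply, ← hf, waveCoef]
  split_ifs with h
  · rw [h, Nat.sub_zero]
    have : ∀ a : Fin 2, (((1 - a : Fin 2) : ℕ) : ℝ) = 1 - ((a : ℕ) : ℝ) := by
      intro a; fin_cases a <;> simp
    rw [this]; ring
  · ring

/-- Terms with `q > p` are integer multiples of `2π` and drop out. The negative coefficient of the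
sign bit is harmless for the same reason: it changes the angle by a multiple of `2π`, since `e^{-iπ}
= e^{iπ}`. -/
theorem exp_wave_term (p q : Fin m) (x y : Fin 2) :
    Complex.exp ((2 * Real.pi * (waveCoef p * x) * (y * 2 ^ (q : ℕ)) / 2 ^ m : ℝ) * Complex.I)
      = Complex.exp ((if q ≤ p then Real.pi * x * y / 2 ^ ((p : ℕ) - q) else 0 : ℝ)
        * Complex.I) := by
  have hpm := p.2
  have hqm := q.2
  by_cases hx : x = 0
  · simp [hx]
  by_cases hy : y = 0
  · simp [hy]
  have hx1 : x = 1 := by omega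
  have hy1 : y = 1 := by omega
  subst hx1 hy1
  simp only [Fin.val_one, Nat.cast_one, mul_one, one_mul]
  have key : ∀ i : ℕ, i < m → (2 : ℝ) ^ (m - 1 - i) * 2 ^ (q : ℕ) / 2 ^ m
      = 2 ^ (q : ℕ) / 2 ^ i / 2 := by
    intro i hi
    have : (2 : ℝ) ^ m = 2 ^ (m - 1 - i) * 2 ^ i * 2 := by
      rw [← pow_add, ← pow_succ]; congr 1; omega
    rw [this]; field_simp
  have hper : ∀ n : ℤ, Complex.exp (((2 * Real.pi * n : ℝ) : ℂ) * Complex.I) = 1 := by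
    intro n
    rw [Complex.exp_eq_one_iff]
    exact ⟨n, by push_cast; ring⟩
  have hpow : ∀ i : ℕ, (i : ℕ) < q → (2 : ℝ) ^ (q : ℕ) / 2 ^ i / 2 = 2 ^ ((q : ℕ) - i - 1) := by
    intro i hi
    have : (2 : ℝ) ^ (q : ℕ) = 2 ^ ((q : ℕ) - i - 1) * 2 ^ i * 2 := by
      rw [← pow_add, ← pow_succ]; congr 1; omega
    rw [this]; field_simp
  by_cases hp : (p : ℕ) = 0
  · have h0 := key 0 (by omega)
    simp only [Nat.sub_zero, pow_zero, div_one] at h0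
    have e : (2 * Real.pi * waveCoef p * 2 ^ (q : ℕ) / 2 ^ m : ℝ)
        = -(2 * Real.pi) * (2 ^ (q : ℕ) / 2) := by
      rw [← h0, waveCoef, if_pos hp]; ring
    rw [e]
    by_cases hq : (q : ℕ) = 0
    · rw [if_pos (by rw [Fin.le_def]; omega), hp, hq]
      have : Complex.exp (((-(2 * Real.pi) * (2 ^ 0 / 2) : ℝ) : ℂ) * Complex.I) = -1 := by
        push_cast
        rw [show (-(2 * Real.pi) * (2 ^ 0 / 2) : ℂ) * Complex.I = -(Real.pi * Complex.I) by ring,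
          Complex.exp_neg, Complex.exp_pi_mul_I]
        norm_num
      rw [this]
      simp
    · rw [if_neg (by rw [Fin.le_def]; omega)]
      have h1 := hpow 0 (by omega)
      simp only [pow_zero, div_one, Nat.sub_zero] at h1
      have h2 := hper (-2 ^ ((q : ℕ) - 1))
      rw [h1]
      push_cast at h2 ⊢
      simp only [zero_mul, Complex.exp_zero]
      rw [← h2]
      congr 1
      ring
  · have e : (2 * Real.pi * waveCoef p * 2 ^ (q : ℕ) / 2 ^ m : ℝ)
        = 2 * Real.pi * (2 ^ (q : ℕ) / 2 ^ (p : ℕ) / 2) := by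
      rw [← key p hpm, waveCoef, if_neg hp]; ring
    rw [e]
    by_cases hq : q ≤ p
    · rw [if_pos hq]
      have : (2 : ℝ) ^ (p : ℕ) = 2 ^ ((p : ℕ) - q) * 2 ^ (q : ℕ) := by
        rw [← pow_add]; congr 1; rw [Fin.le_def] at hq; omega
      rw [this]
      congr 3
      field_simp
    · rw [if_neg hq, hpow p (by rw [Fin.le_def] at hq; omega)]
      have h2 := hper (2 ^ ((q : ℕ) - p - 1))
      push_cast at h2 ⊢
      simp only [zero_mul, Complex.exp_zero]
      exact h2

variable (m) in
/-- The unitary Fourier matrix. -/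
def unitaryFourier : Matrix (Fin (2 ^ m)) (Fin (2 ^ m)) ℂ :=
  ((qft m m m)ᴴ).submatrix finFunctionFinEquiv.symm (freqBits m)

theorem unitaryFourier_mem : unitaryFourier m ∈ unitaryGroup (Fin (2 ^ m)) ℂ := by
  rw [mem_unitaryGroup_iff, unitaryFourier, star_eq_conjTranspose, conjTranspose_submatrix,
    submatrix_mul_equiv, conjTranspose_conjTranspose, qft_isometry, submatrix_one_equiv]

/-- The phase `μ_l (x_j - a) = 2π N j / 2^m` is bilinear in the bits of the wave number `N` and of
`j`. Term by term, modulo `2π`, it is the phase of the adjoint of the exact transform. -/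
theorem fourierMatrix_eq {a b : ℝ} (hab : a < b) (hm : 1 ≤ m) :
    fourierMatrix a b m = ((Real.sqrt 2 : ℝ) : ℂ) ^ m • unitaryFourier m := by
  ext j l
  have hs : ((Real.sqrt 2 : ℝ) : ℂ) ^ m ≠ 0 := pow_ne_zero _ (by simp)
  have hba : b - a ≠ 0 := by linarith
  rw [Matrix.smul_apply, unitaryFourier, submatrix_apply, conjTranspose_apply,
    qft_apply m le_rfl, if_pos (fun k hk => absurd k.2 (by omega)), smul_eq_mul, star_mul',
    star_pow, star_inv₀]
  set x := freqBits m l with hx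
  set y := (finFunctionFinEquiv (m := 2) (n := m)).symm j with hy
  have hstar : star ((Real.sqrt 2 : ℝ) : ℂ) = ((Real.sqrt 2 : ℝ) : ℂ) := Complex.conj_ofReal _
  rw [hstar, ← mul_assoc, inv_pow, mul_inv_cancel₀ hs, one_mul]
  have hj : (j : ℝ) = ∑ q : Fin m, (y q : ℝ) * 2 ^ (q : ℕ) := by
    have h1 : (j : ℕ) = ∑ i : Fin m, (y i : ℕ) * 2 ^ (i : ℕ) := by
      rw [← finFunctionFinEquiv_apply, hy, Equiv.apply_symm_apply]
    rw [h1]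
    push_cast
    rfl
  have hphase : freq a b m l * (gridPoint a b m j - a)
      = ∑ p : Fin m, ∑ q : Fin m,
        2 * Real.pi * (waveCoef p * x p) * (y q * 2 ^ (q : ℕ)) / 2 ^ m := by
    rw [freq, ← waveNumber_freqBits hm l, ← hx, gridPoint, hj, waveNumber]
    simp only [← Finset.sum_div, ← Finset.mul_sum, ← Finset.sum_mul]
    field_simp
    ring
  simp only [fourierMatrix, of_apply]
  rw [mul_assoc, ← Complex.ofReal_mul, hphase, mul_comm Complex.I]
  have hR : star (Complex.exp ((-∑ p ∈ Finset.univ.filter fun p : Fin m => (p : ℕ) < m,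
      ∑ q ∈ Finset.univ.filter (· ≤ p), Real.pi * x p * y q / 2 ^ ((p : ℕ) - q) : ℝ) * Complex.I))
      = Complex.exp ((∑ p : Fin m, ∑ q : Fin m,
        (if q ≤ p then Real.pi * x p * y q / 2 ^ ((p : ℕ) - q) else 0) : ℝ) * Complex.I) := by
    rw [Finset.filter_true_of_mem fun p _ => p.2]
    simp only [Finset.sum_filter]
    rw [RCLike.star_def, ← Complex.exp_conj, map_mul, Complex.conj_ofReal, Complex.conj_I,
      Complex.ofReal_neg, neg_mul_neg]
  rw [hR]
  simp only [Complex.ofReal_sum, Finset.sum_mul, Complex.exp_sum]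
  exact Finset.prod_congr rfl fun p _ => Finset.prod_congr rfl fun q _ => exp_wave_term p q _ _

theorem fourierMatrix_inv {a b : ℝ} (hab : a < b) (hm : 1 ≤ m) :
    (fourierMatrix a b m)⁻¹ = (((Real.sqrt 2 : ℝ) : ℂ) ^ m)⁻¹ • (unitaryFourier m)ᴴ := by
  have hs : ((Real.sqrt 2 : ℝ) : ℂ) ^ m ≠ 0 := pow_ne_zero _ (by simp)
  have h := mem_unitaryGroup_iff.1 (unitaryFourier_mem (m := m))
  rw [star_eq_conjTranspose] at h
  refine inv_eq_right_inv ?_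
  rw [fourierMatrix_eq hab hm, smul_mul_smul_comm, mul_inv_cancel₀ hs, h, one_smul]

end FourierBits

/-! ### The operator in the momentum basis -/

section Middle

variable {m : ℕ}

theorem impl_linear_phase (c : Fin m → ℝ) (T : Finset (Fin m)) :
    Impl ((1 : Matrix (Fin 2) (Fin 2) ℂ) ⊗ₖ
      diagonal fun s : Fin m → Fin 2 => Complex.exp ((∑ p ∈ T, c p * s p : ℝ) * Complex.I))
      T.card := by
  induction T using Finset.induction_on with
  | empty => simpa using impl_one
  | insert q T hq ih =>
    rw [Finset.card_insert_of_notMem hq]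
    have h1 := ih.mul (impl_data q (diagonal_phase_mem fun a : Fin 2 => c q * a))
    rw [mux_diagonal q (fun a _ => Complex.exp ((c q * a : ℝ) * Complex.I)) (fun _ _ _ => rfl),
      ← mul_kronecker_mul, diagonal_mul_diagonal, Matrix.one_mul] at h1
    have e : (fun s : Fin m → Fin 2 =>
        Complex.exp ((∑ p ∈ insert q T, c p * s p : ℝ) * Complex.I))
        = fun s => Complex.exp ((∑ p ∈ T, c p * s p : ℝ) * Complex.I) *
          Complex.exp ((c q * s q : ℝ) * Complex.I) := by
      funext s
      rw [← Complex.exp_add, Finset.sum_insert hq]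
      congr 1
      push_cast
      ring
    rw [e]
    exact h1

/-- The dilation of a number `k ∈ [-1, 1]`. -/
def reflection (k : ℝ) : Matrix (Fin 2) (Fin 2) ℂ :=
  !![(k : ℂ), (Real.sqrt (1 - k ^ 2) : ℂ); (Real.sqrt (1 - k ^ 2) : ℂ), -(k : ℂ)]

theorem reflection_mem {k : ℝ} (hk : k ^ 2 ≤ 1) : reflection k ∈ unitaryGroup (Fin 2) ℂ := by
  have h : ((Real.sqrt (1 - k ^ 2) : ℝ) : ℂ) * ((Real.sqrt (1 - k ^ 2) : ℝ) : ℂ)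
      = 1 - (k : ℂ) ^ 2 := by
    rw [← Complex.ofReal_mul, Real.mul_self_sqrt (by linarith)]; push_cast; ring
  rw [mem_unitaryGroup_iff']
  ext i j
  fin_cases i <;> fin_cases j <;>
    simp only [reflection, star_eq_conjTranspose, mul_apply, conjTranspose_apply,
      Fin.sum_univ_two, of_apply, cons_val', cons_val_zero, cons_val_one, Fin.zero_eta, Fin.mk_one,
      RCLike.star_def, map_neg, Complex.conj_ofReal, empty_val', cons_val_fin_one] <;>
    simp <;> first | ring1 | linear_combination h

/-- The first `n` bits. -/
def truncBits (n : ℕ) (s : Fin m → Fin 2) (p : Fin m) : Fin 2 := if (p : ℕ) < n then s p else 0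

theorem truncBits_eq_iff {n : ℕ} {s u : Fin m → Fin 2} (hu : truncBits n u = u) :
    truncBits n s = u ↔ ∀ p : Fin m, (p : ℕ) < n → s p = u p := by
  constructor
  · rintro rfl p hp
    simp [truncBits, hp]
  · intro h
    rw [← hu]
    funext p
    by_cases hp : (p : ℕ) < n
    · simp [truncBits, hp, h p hp]
    · simp [truncBits, hp]

/-- Each exceptional prefix costs one prefix-controlled gate; all other strings share the default
`reflection 0 = X`, which is a single uncontrolled gate. -/
theorem impl_multiplexed_reflection {n : ℕ} (hn : n ≤ m) (g : (Fin m → Fin 2) → ℝ)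
    (hg : ∀ u, g u ^ 2 ≤ 1) (E : Finset (Fin m → Fin 2)) (hE : ∀ u ∈ E, truncBits n u = u) :
    Impl (blockDiagonal fun s : Fin m → Fin 2 =>
      reflection (if truncBits n s ∈ E then g (truncBits n s) else 0))
      (E.card * (3 + 10 * n) + 1) := by
  have h0 : reflection 0 ∈ unitaryGroup (Fin 2) ℂ := reflection_mem (by norm_num)
  induction E using Finset.induction_on with
  | empty => simpa using impl_dilation (m := m) h0
  | insert u E hu ih =>
    have hu' := hE u (Finset.mem_insert_self u E)
    have h1 := ih fun v hv => hE v (Finset.mem_insert_of_mem hv)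
    -- On the cell of `u` the default is already in place; the extra factor `reflection 0`, an
    -- involution, cancels it.
    have h2 := (impl_prefix_ctrl u hn (mul_mem (reflection_mem (hg u)) h0)).mul h1
    rw [← blockDiagonal_mul] at h2
    rw [Finset.card_insert_of_notMem hu, show (E.card + 1) * (3 + 10 * n) + 1
      = 3 + 10 * n + (E.card * (3 + 10 * n) + 1) by ring]
    refine (congrArg (fun F => Impl (blockDiagonal F) _) (funext fun s => ?_)).mpr h2
    have h00 : reflection 0 * reflection 0 = 1 := by
      ext i j
      fin_cases i <;> fin_cases j <;> simp [reflection, mul_apply]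
    by_cases hs : truncBits n s = u
    · rw [if_pos ((truncBits_eq_iff hu').1 hs), hs, if_pos (Finset.mem_insert_self u E), if_neg hu,
        Matrix.mul_assoc, h00, Matrix.mul_one]
    · rw [if_neg fun h => hs ((truncBits_eq_iff hu').2 h), Matrix.one_mul]
      simp [hs]

/-- Each block is a multiple of a reflection, so `Y† Y` is diagonal with entries `x² + y²`. -/
theorem norm_blockDiagonal_le {ι : Type*} [Fintype ι] [DecidableEq ι] {x y : ι → ℝ} {B : ℝ}
    (hB : 0 ≤ B) (h : ∀ i, x i ^ 2 + y i ^ 2 ≤ B ^ 2) :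
    ‖blockDiagonal fun i => (!![(x i : ℂ), (y i : ℂ); (y i : ℂ), -(x i : ℂ)] :
      Matrix (Fin 2) (Fin 2) ℂ)‖ ≤ B := by
  set Y := blockDiagonal fun i => (!![(x i : ℂ), (y i : ℂ); (y i : ℂ), -(x i : ℂ)] :
      Matrix (Fin 2) (Fin 2) ℂ) with hY
  have h1 : Yᴴ * Y = diagonal fun p : Fin 2 × ι => ((x p.2 ^ 2 + y p.2 ^ 2 : ℝ) : ℂ) := by
    rw [hY, blockDiagonal_conjTranspose, ← blockDiagonal_mul,
      ← blockDiagonal_diagonal (fun (i : ι) (_ : Fin 2) => ((x i ^ 2 + y i ^ 2 : ℝ) : ℂ))]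
    congr 1
    funext i
    ext a b
    fin_cases a <;> fin_cases b <;> simp [mul_apply] <;> ring
  have h2 := l2_opNorm_conjTranspose_mul_self Y
  rw [h1, l2_opNorm_diagonal] at h2
  have h3 : ‖fun p : Fin 2 × ι => ((x p.2 ^ 2 + y p.2 ^ 2 : ℝ) : ℂ)‖ ≤ B ^ 2 := by
    refine (pi_norm_le_iff_of_nonneg (by positivity)).2 fun p => ?_
    rw [Complex.norm_real, Real.norm_eq_abs, abs_of_nonneg (by positivity)]
    exact h p.2
  rw [h2, ← sq] at h3
  exact (sq_le_sq₀ (norm_nonneg _) hB).1 h3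

/-- The off-diagonal entry `√(1 - k²)` is only Hölder continuous of order `1/2` near `k = 1`, whence
the square root. The squared diagonal and off-diagonal differences contribute `2η` and `4η`. -/
theorem norm_blockDiagonal_reflection_sub_le {ι : Type*} [Fintype ι] [DecidableEq ι]
    {k k' : ι → ℝ} {η : ℝ} (hk : ∀ i, k i ∈ Set.Icc (0 : ℝ) 1)
    (hk' : ∀ i, k' i ∈ Set.Icc (0 : ℝ) 1) (h : ∀ i, |k' i - k i| ≤ 2 * η) (hη : 0 ≤ η) :
    ‖(blockDiagonal fun i => reflection (k' i)) - blockDiagonal fun i => reflection (k i)‖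
      ≤ Real.sqrt (6 * η) := by
  have e : (blockDiagonal fun i => reflection (k' i)) - blockDiagonal (fun i => reflection (k i))
      = blockDiagonal fun i =>
        (!![((k' i - k i : ℝ) : ℂ), ((Real.sqrt (1 - k' i ^ 2) - Real.sqrt (1 - k i ^ 2) : ℝ) : ℂ);
          ((Real.sqrt (1 - k' i ^ 2) - Real.sqrt (1 - k i ^ 2) : ℝ) : ℂ), -((k' i - k i : ℝ) : ℂ)] :
          Matrix (Fin 2) (Fin 2) ℂ) := by
    rw [← blockDiagonal_sub]
    congr 1
    funext i
    ext a b
    fin_cases a <;> fin_cases b <;> (simp [reflection]; try ring)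
  rw [e]
  refine norm_blockDiagonal_le (Real.sqrt_nonneg _) fun i => ?_
  rw [Real.sq_sqrt (by positivity)]
  obtain ⟨a0, a1⟩ := hk i
  obtain ⟨b0, b1⟩ := hk' i
  have h := h i
  set p := k i
  set q := k' i
  have hp : 0 ≤ 1 - p ^ 2 := by nlinarith
  have hq : 0 ≤ 1 - q ^ 2 := by nlinarith
  have s1 := Real.sqrt_nonneg (1 - p ^ 2)
  have s2 := Real.sqrt_nonneg (1 - q ^ 2)
  have t1 := Real.sq_sqrt hp
  have t2 := Real.sq_sqrt hq
  have h1 : |q - p| ≤ 1 := abs_le.2 ⟨by linarith, by linarith⟩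
  have h2 : (q - p) ^ 2 ≤ 2 * η := by
    rw [← sq_abs]; nlinarith [abs_nonneg (q - p)]
  have h3 : (Real.sqrt (1 - q ^ 2) - Real.sqrt (1 - p ^ 2)) ^ 2 ≤ |p ^ 2 - q ^ 2| := by
    set c := Real.sqrt (1 - p ^ 2)
    set d := Real.sqrt (1 - q ^ 2)
    have : p ^ 2 - q ^ 2 = (d - c) * (d + c) := by linear_combination t1 - t2
    rw [this, abs_mul, ← sq_abs, sq]
    refine mul_le_mul_of_nonneg_left ?_ (abs_nonneg _)
    rw [abs_of_nonneg (add_nonneg s2 s1)]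
    exact abs_le.2 ⟨by linarith, by linarith⟩
  have h4 : |p ^ 2 - q ^ 2| ≤ 2 * |q - p| := by
    rw [show p ^ 2 - q ^ 2 = (p + q) * -(q - p) by ring, abs_mul, abs_neg,
      abs_of_nonneg (add_nonneg a0 b0)]
    gcongr
    linarith
  linarith

/-- The evolution on bit strings in terms of the Fourier transform: phases `θ n` and dilations of
`k` in the momentum basis. -/
def bitEvolution (θ : ℝ) (k : (Fin m → Fin 2) → ℝ) :
    Matrix (Fin 2 × (Fin m → Fin 2)) (Fin 2 × (Fin m → Fin 2)) ℂ :=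
  ((1 : Matrix (Fin 2) (Fin 2) ℂ) ⊗ₖ qft m m m)ᴴ *
    ((((1 : Matrix (Fin 2) (Fin 2) ℂ) ⊗ₖ
      diagonal fun s => Complex.exp ((θ * waveNumber s : ℝ) * Complex.I)) *
      blockDiagonal fun s => reflection (k s)) * ((1 : Matrix (Fin 2) (Fin 2) ℂ) ⊗ₖ qft m m m))

/-- Only three factors are inexact: the transform, its adjoint and the reflections. They are
replaced one at a time, and their errors add. -/
theorem exists_impl_near_bitEvolution (θ : ℝ) {k g : (Fin m → Fin 2) → ℝ} {n : ℕ} (hn : n ≤ m)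
    (t : ℕ) {η : ℝ} (hη : 0 ≤ η) (hk : ∀ s, k s ∈ Set.Icc (0 : ℝ) 1)
    (hg : ∀ s, g s ∈ Set.Icc (0 : ℝ) 1)
    (E : Finset (Fin m → Fin 2)) (hE : ∀ u ∈ E, truncBits n u = u)
    (h : ∀ s, |(if truncBits n s ∈ E then g (truncBits n s) else 0) - k s| ≤ 2 * η) :
    ∃ V, Impl V (2 * (m * (t + 1)) + m + (E.card * (3 + 10 * n) + 1)) ∧
      ‖V - bitEvolution θ k‖ ≤ 2 * (m * (Real.pi / 2 ^ t)) + Real.sqrt (6 * η) := by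
  set X := (1 : Matrix (Fin 2) (Fin 2) ℂ) ⊗ₖ qft m m m with hX
  set Y := (1 : Matrix (Fin 2) (Fin 2) ℂ) ⊗ₖ qft m t m with hY
  set P := (1 : Matrix (Fin 2) (Fin 2) ℂ) ⊗ₖ
      diagonal fun s : Fin m → Fin 2 => Complex.exp ((θ * waveNumber s : ℝ) * Complex.I) with hP
  set N := blockDiagonal fun s => reflection (k s) with hN
  set N' := blockDiagonal fun s => reflection (if truncBits n s ∈ E then g (truncBits n s) else 0)
    with hN'
  have iX : Impl X _ := impl_qft m m
  have iY : Impl Y _ := impl_qft t m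
  have iP : Impl P m := by
    have := impl_linear_phase (m := m) (fun p => θ * waveCoef p) Finset.univ
    rw [Finset.card_univ, Fintype.card_fin] at this
    convert this using 7
    rw [waveNumber, Finset.mul_sum]
    exact Finset.sum_congr rfl fun p _ => by ring
  have iN' : Impl N' _ := impl_multiplexed_reflection hn g
    (fun u => by have := hg u; nlinarith [this.1, this.2]) E hE
  have hd : ‖N' - N‖ ≤ Real.sqrt (6 * η) := by
    refine norm_blockDiagonal_reflection_sub_le hk (fun s => ?_) h hη
    split_ifs
    exacts [hg _, ⟨le_rfl, zero_le_one⟩]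
  have hXY : ‖Y - X‖ ≤ m * (Real.pi / 2 ^ t) := norm_qft_sub_le t m
  have hXY' : ‖Yᴴ - Xᴴ‖ ≤ m * (Real.pi / 2 ^ t) := by
    rwa [← conjTranspose_sub, l2_opNorm_conjTranspose]
  have nX := norm_le_one_of_isometry iX.conjTranspose_mul_self
  have nXa := norm_le_one_of_isometry iX.adj.conjTranspose_mul_self
  have nY := norm_le_one_of_isometry iY.conjTranspose_mul_self
  have nP := norm_le_one_of_isometry iP.conjTranspose_mul_self
  have nPN := norm_le_one_of_isometry (iP.mul iN').conjTranspose_mul_self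
  refine ⟨Yᴴ * ((P * N') * Y), ?_, ?_⟩
  · refine (iY.adj.mul ((iP.mul iN').mul iY)).mono ?_
    omega
  · have e : Yᴴ * ((P * N') * Y) - bitEvolution θ k
        = (Yᴴ - Xᴴ) * ((P * N') * Y) + (Xᴴ * ((P * N') * (Y - X)) + Xᴴ * ((P * (N' - N)) * X)) := by
      rw [bitEvolution, ← hX, ← hP, ← hN]
      simp only [Matrix.sub_mul, Matrix.mul_sub]
      abel
    rw [e]
    have b1 : ‖(Yᴴ - Xᴴ) * ((P * N') * Y)‖ ≤ m * (Real.pi / 2 ^ t) * (1 * 1) :=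
      (l2_opNorm_mul _ _).trans (mul_le_mul hXY' ((l2_opNorm_mul _ _).trans
        (mul_le_mul nPN nY (norm_nonneg _) zero_le_one)) (norm_nonneg _) (by positivity))
    have b2 : ‖Xᴴ * ((P * N') * (Y - X))‖ ≤ 1 * (1 * (m * (Real.pi / 2 ^ t))) :=
      (l2_opNorm_mul _ _).trans (mul_le_mul nXa ((l2_opNorm_mul _ _).trans
        (mul_le_mul nPN hXY (norm_nonneg _) zero_le_one)) (norm_nonneg _) zero_le_one)
    have b3 : ‖Xᴴ * ((P * (N' - N)) * X)‖ ≤ 1 * (1 * Real.sqrt (6 * η) * 1) :=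
      (l2_opNorm_mul _ _).trans (mul_le_mul nXa ((l2_opNorm_mul _ _).trans
        (mul_le_mul ((l2_opNorm_mul _ _).trans (mul_le_mul nP hd (norm_nonneg _) zero_le_one)) nX
          (norm_nonneg _) (by positivity))) (norm_nonneg _) zero_le_one)
    refine (norm_add_le _ _).trans ?_
    have := norm_add_le (Xᴴ * ((P * N') * (Y - X))) (Xᴴ * ((P * (N' - N)) * X))
    linarith

end Middle

/-! ### Unitarily diagonalised matrices -/

section ConjDiag

set_option linter.unusedSectionVars false

variable {ι : Type*} [Fintype ι] [DecidableEq ι] {F : Matrix ι ι ℂ}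

/-- The matrix with eigenvalues `d` in the orthonormal basis formed by the columns of `F`. -/
def conjDiag (F : Matrix ι ι ℂ) (d : ι → ℂ) : Matrix ι ι ℂ := F * diagonal d * Fᴴ

theorem conjTranspose_mul_of_mem (hF : F ∈ unitaryGroup ι ℂ) : Fᴴ * F = 1 :=
  mem_unitaryGroup_iff'.1 hF

theorem mul_conjTranspose_of_mem (hF : F ∈ unitaryGroup ι ℂ) : F * Fᴴ = 1 :=
  mem_unitaryGroup_iff.1 hF

theorem conjDiag_mul (hF : F ∈ unitaryGroup ι ℂ) (d e : ι → ℂ) :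
    conjDiag F d * conjDiag F e = conjDiag F fun i => d i * e i := by
  calc conjDiag F d * conjDiag F e = F * diagonal d * (Fᴴ * F) * diagonal e * Fᴴ := by
        simp only [conjDiag, Matrix.mul_assoc]
    _ = _ := by
        rw [conjTranspose_mul_of_mem hF, Matrix.mul_one, Matrix.mul_assoc F,
          diagonal_mul_diagonal, conjDiag]

theorem conjDiag_add (d e : ι → ℂ) :
    conjDiag F d + conjDiag F e = conjDiag F fun i => d i + e i := by
  simp only [conjDiag]
  rw [← Matrix.add_mul, ← Matrix.mul_add, diagonal_add]

theorem conjDiag_sub (d e : ι → ℂ) :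
    conjDiag F d - conjDiag F e = conjDiag F fun i => d i - e i := by
  simp only [conjDiag]
  rw [← Matrix.sub_mul, ← Matrix.mul_sub, diagonal_sub]

theorem smul_conjDiag (c : ℂ) (d : ι → ℂ) :
    c • conjDiag F d = conjDiag F fun i => c * d i := by
  have : diagonal (fun i => c * d i) = c • diagonal d := (diagonal_smul c d)
  rw [conjDiag, conjDiag, this, Matrix.mul_smul, Matrix.smul_mul]

theorem one_eq_conjDiag (hF : F ∈ unitaryGroup ι ℂ) : 1 = conjDiag F fun _ => 1 := by
  rw [conjDiag, diagonal_one, Matrix.mul_one, mul_conjTranspose_of_mem hF]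

theorem conjDiag_conjTranspose (d : ι → ℂ) :
    (conjDiag F d)ᴴ = conjDiag F fun i => star (d i) := by
  rw [conjDiag, conjTranspose_mul, conjTranspose_mul, conjTranspose_conjTranspose,
    diagonal_conjTranspose, ← Matrix.mul_assoc]
  rfl

theorem conjDiag_pow (hF : F ∈ unitaryGroup ι ℂ) (d : ι → ℂ) (n : ℕ) :
    conjDiag F d ^ n = conjDiag F fun i => d i ^ n := by
  induction n with
  | zero => simpa using one_eq_conjDiag hF
  | succ n ih =>
    rw [pow_succ, ih, conjDiag_mul hF]
    simp only [pow_succ]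

theorem exp_conjDiag (hF : F ∈ unitaryGroup ι ℂ) (d : ι → ℂ) :
    NormedSpace.exp (conjDiag F d) = conjDiag F fun i => Complex.exp (d i) := by
  have hinv : F⁻¹ = Fᴴ := inv_eq_right_inv (mul_conjTranspose_of_mem hF)
  have hu : IsUnit F := IsUnit.of_mul_eq_one _ (mul_conjTranspose_of_mem hF)
  have h := Matrix.exp_conj F (diagonal d) hu
  rw [hinv] at h
  rw [conjDiag, h, exp_diagonal, conjDiag]
  congr 3
  funext i
  rw [Pi.coe_exp, Complex.exp_eq_exp_ℂ]

theorem aeval_conjDiag (hF : F ∈ unitaryGroup ι ℂ) (d : ι → ℝ) (q : Polynomial ℝ) :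
    Polynomial.aeval (conjDiag F fun i => (d i : ℂ)) q
      = conjDiag F fun i => ((q.eval (d i) : ℝ) : ℂ) := by
  induction q using Polynomial.induction_on' with
  | add p q hp hq =>
    rw [map_add, hp, hq, conjDiag_add]
    simp
  | monomial n a =>
    rw [Polynomial.aeval_monomial, conjDiag_pow hF, ← Algebra.smul_def,
      ← Complex.coe_smul a, smul_conjDiag]
    simp

theorem spectrum_conjDiag_subset (hF : F ∈ unitaryGroup ι ℂ) (d : ι → ℝ) :
    spectrum ℝ (conjDiag F fun i => (d i : ℂ)) ⊆ Set.range d := by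
  intro x hx
  by_contra hxd
  refine hx (spectrum.mem_resolventSet_iff.2 ?_)
  have h : algebraMap ℝ (Matrix ι ι ℂ) x - conjDiag F (fun i => (d i : ℂ))
      = conjDiag F fun i => (x : ℂ) - d i := by
    rw [Algebra.algebraMap_eq_smul_one, ← Complex.coe_smul, one_eq_conjDiag hF, smul_conjDiag,
      conjDiag_sub]
    simp
  rw [h]
  refine IsUnit.of_mul_eq_one (conjDiag F fun i => ((x : ℂ) - d i)⁻¹) ?_
  rw [conjDiag_mul hF, one_eq_conjDiag hF]
  congr 1
  funext i
  refine mul_inv_cancel₀ (sub_ne_zero.2 fun h => hxd ⟨i, ?_⟩)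
  exact_mod_cast h.symm

/-- On the finite spectrum `f` agrees with a Lagrange interpolation polynomial, and for polynomials
the claim is algebra. No continuity of `f` is needed. -/
theorem cfc_conjDiag (hF : F ∈ unitaryGroup ι ℂ) (f : ℝ → ℝ) (d : ι → ℝ) :
    cfc f (conjDiag F fun i => (d i : ℂ)) = conjDiag F fun i => ((f (d i) : ℝ) : ℂ) := by
  have hsa : IsSelfAdjoint (conjDiag F fun i => (d i : ℂ)) := by
    rw [IsSelfAdjoint, star_eq_conjTranspose, conjDiag_conjTranspose]
    simp
  set q := Lagrange.interpolate (Finset.univ.image d) id f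
  have hq : ∀ i, q.eval (d i) = f (d i) := fun i =>
    Lagrange.eval_interpolate_at_node (v := id) f Function.injective_id.injOn
      (Finset.mem_image_of_mem d (Finset.mem_univ i))
  rw [cfc_congr (g := q.eval), cfc_polynomial q _ hsa, aeval_conjDiag hF]
  · simp only [hq]
  · intro x hx
    obtain ⟨i, rfl⟩ := spectrum_conjDiag_subset hF d hx
    exact (hq i).symm

/-- A 2×2 array of matrices diagonal in a common basis is, in that basis, a family of 2×2 matrices
indexed by the eigenvectors. -/
theorem comp_conjDiag (h : ι → Matrix (Fin 2) (Fin 2) ℂ) :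
    Matrix.comp (Fin 2) (Fin 2) ι ι ℂ (of fun c c' => conjDiag F fun i => h i c c')
      = ((1 : Matrix (Fin 2) (Fin 2) ℂ) ⊗ₖ F) * blockDiagonal h *
        ((1 : Matrix (Fin 2) (Fin 2) ℂ) ⊗ₖ Fᴴ) := by
  ext ⟨c, i⟩ ⟨c', i'⟩
  have e1 : ∀ d l, (((1 : Matrix (Fin 2) (Fin 2) ℂ) ⊗ₖ F) * blockDiagonal h) (c, i) (d, l)
      = F i l * h l c d := by
    intro d l
    rw [mul_apply, Fintype.sum_prod_type, Finset.sum_eq_single c, Finset.sum_eq_single l]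
    · simp [blockDiagonal_apply]
    · intro k _ hk; simp [blockDiagonal_apply, hk]
    · simp
    · intro k _ hk; simp [hk.symm]
    · simp
  rw [mul_apply, Fintype.sum_prod_type, Finset.sum_eq_single c']
  · simp only [e1, kroneckerMap_apply, one_apply_eq, one_mul]
    simp only [Matrix.comp_apply, of_apply, conjDiag, mul_apply (M := F * _), mul_diagonal]
  · intro k _ hk; simp [hk]
  · simp

theorem one_kronecker_diagonal (d : ι → ℂ) :
    (1 : Matrix (Fin 2) (Fin 2) ℂ) ⊗ₖ diagonal d = blockDiagonal fun i => d i • 1 := by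
  ext ⟨c, i⟩ ⟨c', i'⟩
  by_cases h : i = i'
  · subst h; simp [blockDiagonal_apply, mul_comm]
  · simp [blockDiagonal_apply, h]

theorem one_kronecker_mem {G : Matrix ι ι ℂ} (hG : G ∈ unitaryGroup ι ℂ) :
    (1 : Matrix (Fin 2) (Fin 2) ℂ) ⊗ₖ G ∈ unitaryGroup (Fin 2 × ι) ℂ := by
  rw [mem_unitaryGroup_iff', star_eq_conjTranspose, conjTranspose_kronecker, ← mul_kronecker_mul,
    conjTranspose_mul_of_mem hG, conjTranspose_one, Matrix.one_mul, one_kronecker_one]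

theorem hermPart_conjDiag (x y : ι → ℝ) :
    hermPart (conjDiag F fun i => (x i : ℂ) + Complex.I * (y i : ℂ))
      = conjDiag F fun i => (x i : ℂ) := by
  rw [hermPart, conjDiag_conjTranspose, conjDiag_add, smul_conjDiag]
  congr 1
  funext i
  simp
  ring

theorem antiHermPart_conjDiag (x y : ι → ℝ) :
    antiHermPart (conjDiag F fun i => (x i : ℂ) + Complex.I * (y i : ℂ))
      = conjDiag F fun i => (y i : ℂ) := by
  rw [antiHermPart, conjDiag_conjTranspose, conjDiag_sub, smul_conjDiag]
  congr 1
  funext i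
  simp
  field_simp
  linear_combination (-2 * y i : ℂ) * Complex.I_sq

theorem dilation_conjDiag (hF : F ∈ unitaryGroup ι ℂ) (k : ι → ℝ) :
    dilation (conjDiag F fun i => (k i : ℂ))
      = ((1 : Matrix (Fin 2) (Fin 2) ℂ) ⊗ₖ F) * (blockDiagonal fun i => reflection (k i)) *
        ((1 : Matrix (Fin 2) (Fin 2) ℂ) ⊗ₖ Fᴴ) := by
  have h1 : (1 : Matrix ι ι ℂ) - conjDiag F (fun i => (k i : ℂ)) * conjDiag F (fun i => (k i : ℂ))
      = conjDiag F fun i => ((1 - k i ^ 2 : ℝ) : ℂ) := by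
    rw [conjDiag_mul hF, one_eq_conjDiag hF, conjDiag_sub]
    congr 1
    funext i
    push_cast
    ring
  have h2 : -conjDiag F (fun i => (k i : ℂ)) = conjDiag F fun i => -(k i : ℂ) := by
    rw [← neg_one_smul ℂ, smul_conjDiag]
    simp
  rw [← comp_conjDiag, dilation, h1, cfc_conjDiag hF, h2]
  congr 1
  ext c c' : 2
  fin_cases c <;> fin_cases c' <;> rfl

variable (F) in
theorem evolutionDilation_conjDiag (hF : F ∈ unitaryGroup ι ℂ) (x y : ι → ℝ) (T : ℝ) :
    evolutionDilation (conjDiag F fun i => (x i : ℂ) + Complex.I * (y i : ℂ)) T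
      = ((1 : Matrix (Fin 2) (Fin 2) ℂ) ⊗ₖ F) *
        (((1 : Matrix (Fin 2) (Fin 2) ℂ) ⊗ₖ
            diagonal fun i => Complex.exp ((T * y i : ℝ) * Complex.I)) *
          (blockDiagonal fun i => reflection (Real.exp (T * x i)))) *
        ((1 : Matrix (Fin 2) (Fin 2) ℂ) ⊗ₖ Fᴴ) := by
  rw [evolutionDilation, hermPart_conjDiag, antiHermPart_conjDiag, smul_conjDiag, smul_conjDiag,
    exp_conjDiag hF, exp_conjDiag hF]
  have h1 : (fun i => Complex.exp ((T : ℂ) * (x i : ℂ)))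
      = fun i => ((Real.exp (T * x i) : ℝ) : ℂ) := by
    funext i; push_cast; rfl
  have h2 : (fun i => Complex.exp (Complex.I * (T : ℂ) * (y i : ℂ)))
      = fun i => Complex.exp ((T * y i : ℝ) * Complex.I) := by
    funext i; push_cast; congr 1; ring
  have hFF : ((1 : Matrix (Fin 2) (Fin 2) ℂ) ⊗ₖ Fᴴ) * ((1 : Matrix (Fin 2) (Fin 2) ℂ) ⊗ₖ F)
      = 1 := by
    rw [← mul_kronecker_mul, conjTranspose_mul_of_mem hF, Matrix.one_mul, one_kronecker_one]
  have h3 : ∀ d : ι → ℂ, (1 : Matrix (Fin 2) (Fin 2) ℂ) ⊗ₖ conjDiag F d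
      = ((1 : Matrix (Fin 2) (Fin 2) ℂ) ⊗ₖ F) * ((1 : Matrix (Fin 2) (Fin 2) ℂ) ⊗ₖ diagonal d) *
        ((1 : Matrix (Fin 2) (Fin 2) ℂ) ⊗ₖ Fᴴ) := by
    intro d
    rw [← mul_kronecker_mul, ← mul_kronecker_mul, Matrix.one_mul, Matrix.one_mul, conjDiag]
  rw [h1, h2, dilation_conjDiag hF, h3]
  set N := blockDiagonal fun i => reflection (Real.exp (T * x i)) with hN
  set P := (1 : Matrix (Fin 2) (Fin 2) ℂ) ⊗ₖ
            diagonal fun i => Complex.exp ((T * y i : ℝ) * Complex.I) with hP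
  -- The phases are scalars on each 2×2 block.
  have hc : N * P = P * N := by
    rw [hP, one_kronecker_diagonal, hN, ← blockDiagonal_mul, ← blockDiagonal_mul]
    simp
  set X := (1 : Matrix (Fin 2) (Fin 2) ℂ) ⊗ₖ F
  set Y := (1 : Matrix (Fin 2) (Fin 2) ℂ) ⊗ₖ Fᴴ
  calc X * N * Y * (X * P * Y) = X * N * (Y * X) * P * Y := by simp only [Matrix.mul_assoc]
    _ = X * (P * N) * Y := by rw [hFF, Matrix.mul_one, Matrix.mul_assoc X, hc]

theorem blockDiagonal_mem {h : ι → Matrix (Fin 2) (Fin 2) ℂ}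
    (hh : ∀ i, h i ∈ unitaryGroup (Fin 2) ℂ) : blockDiagonal h ∈ unitaryGroup (Fin 2 × ι) ℂ := by
  rw [mem_unitaryGroup_iff', star_eq_conjTranspose, blockDiagonal_conjTranspose,
    ← blockDiagonal_mul, ← blockDiagonal_one]
  congr 1
  funext i
  exact mem_unitaryGroup_iff'.1 (hh i)

theorem evolutionDilation_mem (hF : F ∈ unitaryGroup ι ℂ) {x : ι → ℝ} (y : ι → ℝ) {T : ℝ}
    (hx : ∀ i, T * x i ≤ 0) :
    evolutionDilation (conjDiag F fun i => (x i : ℂ) + Complex.I * (y i : ℂ)) T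
      ∈ unitaryGroup (Fin 2 × ι) ℂ := by
  rw [evolutionDilation_conjDiag F hF]
  refine mul_mem (mul_mem (one_kronecker_mem hF) (mul_mem (one_kronecker_mem
    (diagonal_phase_mem _)) (blockDiagonal_mem fun i => reflection_mem ?_)))
    (one_kronecker_mem (Unitary.star_mem hF))
  have h1 := Real.exp_le_one_iff.2 (hx i)
  have h0 := (Real.exp_pos (T * x i)).le
  nlinarith

theorem evolutionDilation_mulVec_ketZero (A : Matrix ι ι ℂ) (T : ℝ) (v : ι → ℂ) (j : ι) :
    (evolutionDilation A T).mulVec (ketZero v) (0, j)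
      = ((NormedSpace.exp ((T : ℂ) • hermPart A) *
        NormedSpace.exp ((Complex.I * (T : ℂ)) • antiHermPart A)).mulVec v) j := by
  have h : ∀ j', evolutionDilation A T (0, j) (0, j') =
      (NormedSpace.exp ((T : ℂ) • hermPart A) *
        NormedSpace.exp ((Complex.I * (T : ℂ)) • antiHermPart A)) j j' := by
    intro j'
    rw [evolutionDilation, mul_apply, mul_apply, Fintype.sum_prod_type, Finset.sum_eq_single 0]
    · simp [dilation]
    · intro k _ hk; simp [hk]
    · simp
  simp only [mulVec, dotProduct, Fintype.sum_prod_type, Fin.sum_univ_two, h, ketZero]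
  simp

theorem conjDiag_mulVec (d : ι → ℂ) (v : ι → ℂ) :
    (conjDiag F d).mulVec v = F.mulVec fun i => d i * (Fᴴ.mulVec v) i := by
  rw [conjDiag, ← mulVec_mulVec, ← mulVec_mulVec]
  congr 1
  funext i
  rw [mulVec_diagonal]

/-- Integrating factor: `e^{-tα} c(t)` has derivative zero on the interval. -/
theorem eq_exp_mul_of_hasDerivWithinAt {T : ℝ} (hT : 0 ≤ T) (α : ℂ) (c : ℝ → ℂ)
    (h : ∀ t ∈ Set.Icc 0 T, HasDerivWithinAt c (α * c t) (Set.Icc 0 T) t) :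
    c T = Complex.exp (T * α) * c 0 := by
  have hd : ∀ t ∈ Set.Icc 0 T, HasDerivWithinAt (fun t : ℝ => Complex.exp (-(t * α)) * c t) 0
      (Set.Icc 0 T) t := by
    intro t ht
    have h1 : HasDerivAt (fun t : ℝ => Complex.exp (-((t : ℂ) * α)))
        (Complex.exp (-((t : ℂ) * α)) * -(1 * α)) t :=
      (((Complex.ofRealCLM.hasDerivAt (x := t)).mul_const α).neg).cexp
    refine (h1.hasDerivWithinAt.fun_mul (h t ht)).congr_deriv ?_
    ring
  have h0 := (convex_Icc (0 : ℝ) T).norm_image_sub_le_of_norm_hasDerivWithin_le (C := 0) hd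
    (by simp) (Set.left_mem_Icc.2 hT) (Set.right_mem_Icc.2 hT)
  rw [zero_mul, norm_le_zero_iff, sub_eq_zero] at h0
  simp only [Complex.ofReal_zero, zero_mul, neg_zero, Complex.exp_zero, one_mul] at h0
  rw [← h0, ← mul_assoc, ← Complex.exp_add, add_neg_cancel, Complex.exp_zero, one_mul]

/-- The coordinates `F† V` satisfy uncoupled scalar equations, whose solution factors `e^{T(x +
iy)}` are those of the `|0⟩`-block. -/
theorem evolutionDilation_solution (hF : F ∈ unitaryGroup ι ℂ) (x y : ι → ℝ) {T : ℝ}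
    (hT : 0 ≤ T) (V : ℝ → ι → ℂ)
    (hV : ∀ t ∈ Set.Icc 0 T, HasDerivWithinAt V
      ((conjDiag F fun i => (x i : ℂ) + Complex.I * (y i : ℂ)).mulVec (V t)) (Set.Icc 0 T) t)
    (j : ι) :
    (evolutionDilation (conjDiag F fun i => (x i : ℂ) + Complex.I * (y i : ℂ)) T).mulVec
      (ketZero (V 0)) (0, j) = V T j := by
  set α : ι → ℂ := fun i => (x i : ℂ) + Complex.I * (y i : ℂ) with hα
  have hc : ∀ l, (Fᴴ.mulVec (V T)) l = Complex.exp (T * α l) * (Fᴴ.mulVec (V 0)) l := by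
    intro l
    refine eq_exp_mul_of_hasDerivWithinAt hT (α l) (fun t => (Fᴴ.mulVec (V t)) l) fun t ht => ?_
    have h1 := hasDerivWithinAt_pi.1 (hV t ht)
    have h2 : HasDerivWithinAt (fun t => (Fᴴ.mulVec (V t)) l)
        ((Fᴴ.mulVec ((conjDiag F α).mulVec (V t))) l) (Set.Icc 0 T) t := by
      simp only [mulVec, dotProduct]
      exact HasDerivWithinAt.fun_sum fun i _ => (h1 i).const_mul _
    rwa [conjDiag_mulVec, mulVec_mulVec, conjTranspose_mul_of_mem hF, one_mulVec] at h2
  rw [evolutionDilation_mulVec_ketZero, hermPart_conjDiag, antiHermPart_conjDiag, smul_conjDiag,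
    smul_conjDiag, exp_conjDiag hF, exp_conjDiag hF, conjDiag_mul hF, conjDiag_mulVec]
  have h3 : (fun i => Complex.exp ((T : ℂ) * (x i : ℂ)) *
      Complex.exp (Complex.I * (T : ℂ) * (y i : ℂ)) * (Fᴴ.mulVec (V 0)) i) = Fᴴ.mulVec (V T) := by
    funext l
    rw [hc, ← Complex.exp_add]
    congr 2
    simp only [hα]
    ring
  rw [h3, mulVec_mulVec, mul_conjTranspose_of_mem hF, one_mulVec]

end ConjDiag

/-! ### The spectral discretisation in the momentum basis -/

section Generator

variable {m : ℕ} {a b : ℝ}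

theorem momentum_eq (hab : a < b) (hm : 1 ≤ m) :
    momentum a b m = conjDiag (unitaryFourier m) fun l => (freq a b m l : ℂ) := by
  have hs : ((Real.sqrt 2 : ℝ) : ℂ) ^ m ≠ 0 := pow_ne_zero _ (by simp)
  rw [momentum, fourierMatrix_inv hab hm, fourierMatrix_eq hab hm, Matrix.smul_mul,
    Matrix.smul_mul, Matrix.mul_smul, smul_smul, mul_inv_cancel₀ hs, one_smul, conjDiag]

theorem generator_eq (r σ : ℝ) (hab : a < b) (hm : 1 ≤ m) :
    generator r σ a b m = conjDiag (unitaryFourier m) fun l =>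
      ((-(σ ^ 2 / 2 * freq a b m l ^ 2 + r) : ℝ) : ℂ)
        + Complex.I * (((r - σ ^ 2 / 2) * freq a b m l : ℝ) : ℂ) := by
  rw [generator, spectralDeriv, momentum_eq hab hm, smul_conjDiag,
    conjDiag_mul unitaryFourier_mem, smul_conjDiag, smul_conjDiag, conjDiag_add,
    one_eq_conjDiag (unitaryFourier_mem (m := m)), smul_conjDiag, conjDiag_sub]
  congr 1
  funext l
  push_cast
  linear_combination (σ ^ 2 / 2 * freq a b m l ^ 2 : ℂ) * Complex.I_sq

theorem inMomentumBasis_conjDiag (hab : a < b) (hm : 1 ≤ m) (d : Fin (2 ^ m) → ℂ) :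
    inMomentumBasis a b m (conjDiag (unitaryFourier m) d) = diagonal d := by
  have hs : ((Real.sqrt 2 : ℝ) : ℂ) ^ m ≠ 0 := pow_ne_zero _ (by simp)
  have hF := conjTranspose_mul_of_mem (unitaryFourier_mem (m := m))
  rw [inMomentumBasis, fourierMatrix_inv hab hm, fourierMatrix_eq hab hm, Matrix.smul_mul,
    Matrix.smul_mul, Matrix.mul_smul, smul_smul, inv_mul_cancel₀ hs, one_smul, conjDiag,
    Matrix.mul_assoc, Matrix.mul_assoc _ _ (unitaryFourier m), hF, Matrix.mul_one,
    ← Matrix.mul_assoc, hF, Matrix.one_mul]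

theorem generator_dilation_spec (r σ a b T : ℝ) (m : ℕ) (hr : 0 ≤ r) (hab : a < b) (hT : 0 ≤ T)
    (hm : 1 ≤ m) :
    inMomentumBasis a b m (hermPart (generator r σ a b m))
        = diagonal (fun l => ((-(σ ^ 2 / 2 * freq a b m l ^ 2 + r) : ℝ) : ℂ)) ∧
      inMomentumBasis a b m (antiHermPart (generator r σ a b m))
        = diagonal (fun l => (((r - σ ^ 2 / 2) * freq a b m l : ℝ) : ℂ)) ∧
      Commute (inMomentumBasis a b m (hermPart (generator r σ a b m)))
        (inMomentumBasis a b m (antiHermPart (generator r σ a b m))) ∧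
      Commute (hermPart (generator r σ a b m)) (antiHermPart (generator r σ a b m)) ∧
      evolutionDilation (generator r σ a b m) T ∈ unitaryGroup (Fin 2 × Fin (2 ^ m)) ℂ ∧
      (∀ V : ℝ → Fin (2 ^ m) → ℂ,
        (∀ t ∈ Set.Icc 0 T, HasDerivWithinAt V
          ((generator r σ a b m).mulVec (V t)) (Set.Icc 0 T) t) →
        ∀ j, (evolutionDilation (generator r σ a b m) T).mulVec
          (ketZero (V 0)) (0, j) = V T j) := by
  have hF := unitaryFourier_mem (m := m)
  rw [generator_eq r σ hab hm, hermPart_conjDiag, antiHermPart_conjDiag,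
    inMomentumBasis_conjDiag hab hm, inMomentumBasis_conjDiag hab hm]
  refine ⟨rfl, rfl, ?_, ?_, evolutionDilation_mem hF _ fun l => ?_,
    evolutionDilation_solution hF _ _ hT⟩
  · rw [Commute, SemiconjBy, diagonal_mul_diagonal, diagonal_mul_diagonal]
    simp only [mul_comm]
  · rw [Commute, SemiconjBy, conjDiag_mul hF, conjDiag_mul hF]
    simp only [mul_comm]
  · have : 0 ≤ σ ^ 2 / 2 * freq a b m l ^ 2 + r := by positivity
    nlinarith

end Generator

/-! ### From bit strings to grid indices -/

section Transfer

variable {m : ℕ}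

variable (m) in
/-- The binary digits of the data. -/
def dataBits : Fin 2 × Fin (2 ^ m) ≃ Fin 2 × (Fin m → Fin 2) :=
  (Equiv.refl (Fin 2)).prodCongr finFunctionFinEquiv.symm

variable (m) in
/-- The binary digits of the frequency index. -/
def momentumBits : Fin 2 × Fin (2 ^ m) ≃ Fin 2 × (Fin m → Fin 2) :=
  (Equiv.refl (Fin 2)).prodCongr (freqBits m)

/-- The frequency index is summed over inside the product, so it may be relabelled by `freqBits` at
no cost in gates; only the labelling of the grid points survives. -/
theorem evolutionDilation_generator (r σ T : ℝ) {a b : ℝ} (hab : a < b) (hm : 1 ≤ m) :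
    evolutionDilation (generator r σ a b m) T
      = (bitEvolution (T * ((r - σ ^ 2 / 2) * (2 * Real.pi / (b - a)))) fun s : Fin m → Fin 2 =>
          Real.exp (T * -(σ ^ 2 / 2 * (2 * Real.pi / (b - a) * waveNumber s) ^ 2 + r))).submatrix
        (dataBits m) (dataBits m) := by
  have hfreq : ∀ l, freq a b m l = 2 * Real.pi / (b - a) * waveNumber (freqBits m l) := by
    intro l
    rw [waveNumber_freqBits hm, freq]
    ring
  have h1 : (1 : Matrix (Fin 2) (Fin 2) ℂ) ⊗ₖ unitaryFourier m
      = ((1 : Matrix (Fin 2) (Fin 2) ℂ) ⊗ₖ qft m m m)ᴴ.submatrix (dataBits m) (momentumBits m) := by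
    rw [conjTranspose_kronecker, conjTranspose_one]
    rfl
  have h2 : (1 : Matrix (Fin 2) (Fin 2) ℂ) ⊗ₖ (unitaryFourier m)ᴴ
      = ((1 : Matrix (Fin 2) (Fin 2) ℂ) ⊗ₖ qft m m m).submatrix (momentumBits m) (dataBits m) := by
    rw [unitaryFourier, conjTranspose_submatrix, conjTranspose_conjTranspose]
    rfl
  have h3 : ∀ d : (Fin m → Fin 2) → ℂ,
      (1 : Matrix (Fin 2) (Fin 2) ℂ) ⊗ₖ diagonal (fun l => d (freqBits m l))
      = ((1 : Matrix (Fin 2) (Fin 2) ℂ) ⊗ₖ diagonal d).submatrix (momentumBits m)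
        (momentumBits m) := by
    intro d
    have : diagonal (fun l => d (freqBits m l)) = (diagonal d).submatrix (freqBits m)
        (freqBits m) := (submatrix_diagonal_equiv d (freqBits m)).symm
    rw [this]
    rfl
  have h4 : ∀ h : (Fin m → Fin 2) → Matrix (Fin 2) (Fin 2) ℂ,
      (blockDiagonal fun l => h (freqBits m l))
      = (blockDiagonal h).submatrix (momentumBits m) (momentumBits m) := by
    intro h
    ext ⟨c, l⟩ ⟨c', l'⟩
    simp [blockDiagonal_apply, momentumBits]
  rw [generator_eq r σ hab hm, evolutionDilation_conjDiag _ unitaryFourier_mem, h1, h2]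
  simp only [hfreq]
  rw [h3 fun s => Complex.exp ((T * ((r - σ ^ 2 / 2) * (2 * Real.pi / (b - a) * waveNumber s)) : ℝ)
      * Complex.I), h4 fun s => reflection (Real.exp
      (T * -(σ ^ 2 / 2 * (2 * Real.pi / (b - a) * waveNumber s) ^ 2 + r))),
    submatrix_mul_equiv, submatrix_mul_equiv, submatrix_mul_equiv, bitEvolution, Matrix.mul_assoc]
  simp only [mul_assoc]

theorem Impl.implementableWithin {V U : Matrix (Fin 2 × (Fin m → Fin 2)) (Fin 2 × (Fin m → Fin 2)) ℂ}
    {n : ℕ} (hV : Impl V n) {ε G : ℝ} (hε : ‖V - U‖ ≤ ε) (hG : (n : ℝ) ≤ G) :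
    ImplementableWithin m (U.submatrix (dataBits m) (dataBits m)) ε G := by
  obtain ⟨C, ⟨-, c, hc, rfl⟩, hC⟩ := hV
  refine ⟨m + 1, c, (Nat.cast_le.2 hc).trans hG, fun ψ => ?_⟩
  have hadj : adjoinWork m (m + 1) = (dataCols m (m + 1)).submatrix id (dataBits m) := rfl
  have h1 : circuitMatrix c * adjoinWork m (m + 1)
      - adjoinWork m (m + 1) * U.submatrix (dataBits m) (dataBits m)
      = (dataCols m (m + 1) * (V - U)).submatrix id (dataBits m) := by
    rw [hadj, submatrix_mul_equiv, Matrix.mul_sub, ← hC, submatrix_sub]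
    rfl
  have hJ : ‖dataCols m (m + 1)‖ ≤ 1 :=
    norm_le_one_of_isometry (basisCols_isometry (regState_injective _))
  rw [h1, submatrix_mulVec_equiv]
  have h2 : ‖WithLp.toLp 2 (ψ ∘ (dataBits m).symm)‖ = ‖WithLp.toLp 2 ψ‖ := by
    rw [EuclideanSpace.norm_eq, EuclideanSpace.norm_eq]
    congr 1
    exact (dataBits m).symm.sum_comp fun i => ‖ψ i‖ ^ 2
  calc _ ≤ ‖dataCols m (m + 1) * (V - U)‖ * ‖WithLp.toLp 2 (ψ ∘ (dataBits m).symm)‖ :=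
        l2_opNorm_mulVec (dataCols m (m + 1) * (V - U)) (WithLp.toLp 2 (ψ ∘ (dataBits m).symm))
    _ ≤ (1 * ε) * ‖WithLp.toLp 2 ψ‖ := by
        rw [h2]
        gcongr
        exact (l2_opNorm_mul _ _).trans
          (mul_le_mul hJ hε (norm_nonneg _) zero_le_one)
    _ = _ := by rw [one_mul]

theorem ImplementableWithin.mono {U : Matrix (Fin 2 × Fin (2 ^ m)) (Fin 2 × Fin (2 ^ m)) ℂ}
    {ε ε' G G' : ℝ} (h : ImplementableWithin m U ε G) (hε : ε ≤ ε') (hG : G ≤ G') :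
    ImplementableWithin m U ε' G' := by
  obtain ⟨w, c, hc, h⟩ := h
  exact ⟨w, c, hc.trans hG, fun ψ => (h ψ).trans (by gcongr)⟩

end Transfer

/-! ### Truncation of the wave number -/

section Truncation

variable {m : ℕ}

theorem waveNumber_injective (hm : 1 ≤ m) :
    Function.Injective (waveNumber : (Fin m → Fin 2) → ℝ) := by
  intro s s' h
  obtain ⟨l, rfl⟩ := (freqBits m).surjective s
  obtain ⟨l', rfl⟩ := (freqBits m).surjective s'
  rw [waveNumber_freqBits hm, waveNumber_freqBits hm] at h
  have : (l : ℝ) = l' := by linarith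
  rw [Fin.ext (by exact_mod_cast this : (l : ℕ) = l')]

theorem truncBits_truncBits (n : ℕ) (s : Fin m → Fin 2) :
    truncBits n (truncBits n s) = truncBits n s := by
  funext p
  simp only [truncBits]
  split_ifs <;> rfl

theorem truncBits_self (s : Fin m → Fin 2) : truncBits m s = s := by
  funext p
  simp [truncBits]

/-- The last `K` bits have coefficients of modulus `1, 2, …, 2^(K-1)`, with sum `2^K - 1`. Working
with moduli also covers `K = m`, where the sign bit is dropped. -/
theorem abs_waveNumber_sub_truncBits_le {K : ℕ} (hK : K ≤ m) (s : Fin m → Fin 2) :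
    |waveNumber s - waveNumber (truncBits (m - K) s)| ≤ 2 ^ K := by
  have hterm : ∀ p : Fin m, |waveCoef p * s p - waveCoef p * truncBits (m - K) s p|
      ≤ if m - 1 - (p : ℕ) < K then 2 ^ (m - 1 - (p : ℕ)) else 0 := by
    intro p
    by_cases hp : (p : ℕ) < m - K
    · simp only [truncBits, hp, if_true, sub_self, abs_zero]
      split_ifs <;> positivity
    · have hp' : m - 1 - (p : ℕ) < K := by have := p.2; omega
      simp only [truncBits, hp, hp', if_true, if_false, Fin.val_zero, Nat.cast_zero, mul_zero,
        sub_zero, abs_mul, Nat.abs_cast]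
      have h1 : |waveCoef p| = 2 ^ (m - 1 - (p : ℕ)) := by
        rw [waveCoef]
        split_ifs with h0
        · rw [abs_neg, abs_of_nonneg (by positivity), h0, Nat.sub_zero]
        · rw [abs_of_nonneg (by positivity)]
      have h2 : ((s p : ℕ) : ℝ) ≤ 1 := by exact_mod_cast Nat.le_of_lt_succ (s p).2
      rw [h1]
      exact mul_le_of_le_one_right (by positivity) h2
  rw [waveNumber, waveNumber, ← Finset.sum_sub_distrib]
  refine (Finset.abs_sum_le_sum_abs _ _).trans ((Finset.sum_le_sum fun p _ => hterm p).trans ?_)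
  have h1 : ∑ p : Fin m, (if m - 1 - (p : ℕ) < K then (2 : ℝ) ^ (m - 1 - (p : ℕ)) else 0)
      = ∑ p : Fin m, if (p : ℕ) < K then (2 : ℝ) ^ (p : ℕ) else 0 := by
    rw [← Equiv.sum_comp Fin.revPerm]
    refine Finset.sum_congr rfl fun p _ => ?_
    have : m - 1 - (m - ((p : ℕ) + 1)) = p := by have := p.2; omega
    rw [Fin.revPerm_apply, Fin.val_rev, this]
  rw [h1, Fin.sum_univ_eq_sum_range (fun i => if i < K then (2 : ℝ) ^ i else 0) m,
    ← Finset.sum_filter]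
  have h2 : (Finset.range m).filter (· < K) = Finset.range K := by
    ext i; simp only [Finset.mem_filter, Finset.mem_range]; omega
  have h3 := geom_sum_mul (2 : ℝ) K
  rw [h2]
  linarith

/-- The number of truncated strings of small wave number. -/
theorem card_filter_waveNumber_le (hm : 1 ≤ m) {K L : ℕ} (hK : K ≤ m) {δ X : ℝ} (hδ : 0 ≤ δ)
    (hX : 0 < X) (hL : K = m ∨ X ≤ δ * 2 ^ K * L) :
    (Finset.univ.filter fun u : Fin m → Fin 2 =>
      truncBits (m - K) u = u ∧ δ * |waveNumber u| ≤ X).card ≤ 2 * L + 1 := by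
  -- The wave number of a truncated string in units of `2^K`. For `K = m` all bits vanish, so the
  -- truncated subtraction in the exponents does no harm.
  set z : (Fin m → Fin 2) → ℤ := fun u =>
    ∑ p : Fin m, (if (p : ℕ) = 0 then -2 ^ (m - K - 1) else 2 ^ (m - K - 1 - (p : ℕ))) * (u p : ℕ)
    with hz
  have hzN : ∀ u : Fin m → Fin 2, truncBits (m - K) u = u → waveNumber u = 2 ^ K * (z u : ℝ) := by
    intro u hu
    rw [waveNumber, hz]
    push_cast
    rw [Finset.mul_sum]
    refine Finset.sum_congr rfl fun p _ => ?_
    by_cases hp : (p : ℕ) < m - K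
    · have e : ∀ i : ℕ, i < m - K → (2 : ℝ) ^ (m - 1 - i) = 2 ^ K * 2 ^ (m - K - 1 - i) := by
        intro i hi
        rw [← pow_add]; congr 1; omega
      rw [waveCoef]
      split_ifs with h0
      · have := e 0 (by omega)
        simp only [Nat.sub_zero] at this
        rw [this]; ring
      · rw [e p hp]; ring
    · have : u p = 0 := by rw [← hu]; simp [truncBits, hp]
      simp [this]
  have hcard : (Finset.univ.filter fun u : Fin m → Fin 2 =>
      truncBits (m - K) u = u ∧ δ * |waveNumber u| ≤ X).card
      ≤ (Finset.Icc (-(L : ℤ)) L).card := by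
    refine Finset.card_le_card_of_injOn z ?_ ?_
    · intro u hu
      simp only [Finset.coe_filter, Finset.mem_univ, true_and, Set.mem_ofPred_eq] at hu
      have habs : |z u| ≤ (L : ℤ) := by
        rcases hL with hL | hL
        · have hu0 : ∀ p, u p = 0 := fun p => by
            rw [← hu.1]; simp [truncBits, hL]
          simp [hz, hu0]
        · have h1 : δ * 2 ^ K * |(z u : ℝ)| ≤ δ * 2 ^ K * L := by
            have h := hu.2
            rw [hzN u hu.1, abs_mul, abs_of_nonneg (by positivity : (0 : ℝ) ≤ 2 ^ K)] at h
            linarith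
          have hpos : 0 < δ * 2 ^ K := by
            rcases hδ.eq_or_lt with h0 | h0
            · rw [← h0] at hL; simp at hL; linarith
            · positivity
          have h2 := le_of_mul_le_mul_left h1 hpos
          exact_mod_cast h2
      simpa using abs_le.1 habs
    · intro u hu v hv h
      simp only [Finset.coe_filter, Finset.mem_univ, true_and, Set.mem_ofPred_eq] at hu hv
      refine waveNumber_injective hm ?_
      rw [hzN u hu.1, hzN v hv.1, h]
  refine hcard.trans (le_of_eq ?_)
  rw [Int.card_Icc]
  omega

/-- The derivative is bounded by one, as `|2z| ≤ 1 + z² ≤ e^{z²}`. -/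
theorem abs_exp_neg_sq_sub_le (x y : ℝ) :
    |Real.exp (-x ^ 2) - Real.exp (-y ^ 2)| ≤ |x - y| := by
  have hd : ∀ z ∈ (Set.univ : Set ℝ), HasDerivWithinAt (fun z : ℝ => Real.exp (-z ^ 2))
      (Real.exp (-z ^ 2) * -(2 * z)) Set.univ z := by
    intro z _
    have h := ((hasDerivAt_pow 2 z).neg).exp
    refine HasDerivAt.hasDerivWithinAt (h.congr_deriv ?_)
    simp
  have hb : ∀ z ∈ (Set.univ : Set ℝ), ‖Real.exp (-z ^ 2) * -(2 * z)‖ ≤ 1 := by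
    intro z _
    rw [norm_mul, norm_neg, Real.norm_eq_abs, Real.norm_eq_abs, abs_of_pos (Real.exp_pos _),
      Real.exp_neg, inv_mul_le_iff₀ (Real.exp_pos _), mul_one]
    have h1 := Real.add_one_le_exp (z ^ 2)
    refine le_trans ?_ h1
    rw [abs_le]
    constructor <;> nlinarith [sq_nonneg (z - 1), sq_nonneg (z + 1)]
  have h := convex_univ.norm_image_sub_le_of_norm_hasDerivWithin_le hd hb (Set.mem_univ y)
    (Set.mem_univ x)
  simpa [Real.norm_eq_abs] using h

/-- The parameters trade off as follows: `δ` is the inverse width of the Gaussian in the wave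
number, `2^K` the length of a cell, `X` the cutoff in `δ|N|`, `2L + 1` a bound for the number of
cells within the cutoff, and `η` the error allowed to each of the two approximations of `k`. -/
theorem exists_implementable (r σ T : ℝ) {a b : ℝ} (hr : 0 ≤ r) (hab : a < b) (hT : 0 ≤ T)
    (hm : 1 ≤ m) {δ : ℝ} (hδ : δ = Real.sqrt (T * (σ ^ 2 / 2)) * (2 * Real.pi / (b - a)))
    {K L : ℕ} (hK : K ≤ m) (t : ℕ) {η X : ℝ} (hη : 0 ≤ η) (hX : 0 < X)
    (hKη : K = 0 ∨ δ * 2 ^ K ≤ η) (hXη : Real.exp (-X ^ 2) ≤ η)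
    (hL : K = m ∨ X ≤ δ * 2 ^ K * L) :
    ImplementableWithin m (evolutionDilation (generator r σ a b m) T)
      (2 * (m * (Real.pi / 2 ^ t)) + Real.sqrt (6 * η)) (m * (2 * t + 26 * L + 17)) := by
  have hδ0 : 0 ≤ δ := by
    have : 0 < b - a := sub_pos.2 hab
    rw [hδ]; positivity
  set k : (Fin m → Fin 2) → ℝ := fun s =>
    Real.exp (T * -(σ ^ 2 / 2 * (2 * Real.pi / (b - a) * waveNumber s) ^ 2 + r)) with hk
  have hk' : ∀ s, k s = Real.exp (-(T * r)) * Real.exp (-(δ * waveNumber s) ^ 2) := by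
    intro s
    simp only [hk]
    rw [← Real.exp_add]
    congr 1
    have hs : Real.sqrt (T * (σ ^ 2 / 2)) ^ 2 = T * (σ ^ 2 / 2) := Real.sq_sqrt (by positivity)
    rw [hδ]
    linear_combination (2 * Real.pi / (b - a) * waveNumber s) ^ 2 * hs
  have hκ : Real.exp (-(T * r)) ≤ 1 := Real.exp_le_one_iff.2 (by nlinarith)
  have hκ0 := (Real.exp_pos (-(T * r))).le
  have hk01 : ∀ s, k s ∈ Set.Icc (0 : ℝ) 1 := fun s => by
    refine ⟨(Real.exp_pos _).le, ?_⟩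
    rw [hk']
    exact mul_le_one₀ hκ (Real.exp_pos _).le
      (Real.exp_le_one_iff.2 (by nlinarith [sq_nonneg (δ * waveNumber s)]))
  set n := m - K with hn
  set E := Finset.univ.filter fun u : Fin m → Fin 2 => truncBits n u = u ∧ δ * |waveNumber u| ≤ X
    with hE
  have hclose : ∀ s, |k s - k (truncBits n s)| ≤ η := by
    intro s
    rcases hKη with h0 | h0
    · rw [hn, h0, Nat.sub_zero, truncBits_self, sub_self, abs_zero]
      exact hη
    · rw [hk', hk', ← mul_sub, abs_mul, abs_of_nonneg hκ0]
      have h1 := abs_exp_neg_sq_sub_le (δ * waveNumber s) (δ * waveNumber (truncBits n s))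
      have h2 := abs_waveNumber_sub_truncBits_le hK s
      rw [← mul_sub, abs_mul, abs_of_nonneg hδ0] at h1
      have h3 := mul_le_mul_of_nonneg_left h2 hδ0
      have h4 := mul_le_mul_of_nonneg_right hκ (abs_nonneg
        (Real.exp (-(δ * waveNumber s) ^ 2) - Real.exp (-(δ * waveNumber (truncBits n s)) ^ 2)))
      linarith
  have hfar : ∀ s, truncBits n s ∉ E → k (truncBits n s) ≤ η := by
    intro s hs
    have h1 : X < δ * |waveNumber (truncBits n s)| := by
      by_contra h
      refine hs ?_
      simp only [hE, Finset.mem_filter, Finset.mem_univ, true_and]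
      exact ⟨truncBits_truncBits n s, not_lt.1 h⟩
    have h2 : X ^ 2 ≤ (δ * waveNumber (truncBits n s)) ^ 2 := by
      rw [mul_pow, ← sq_abs (waveNumber _), ← mul_pow]
      gcongr
    have h3 : Real.exp (-(δ * waveNumber (truncBits n s)) ^ 2) ≤ η :=
      (Real.exp_le_exp.2 (neg_le_neg h2)).trans hXη
    rw [hk']
    calc _ ≤ 1 * η := mul_le_mul hκ h3 (Real.exp_pos _).le zero_le_one
      _ = η := one_mul η
  obtain ⟨V, hV, hVU⟩ := exists_impl_near_bitEvolution
    (T * ((r - σ ^ 2 / 2) * (2 * Real.pi / (b - a)))) (k := k) (g := k) (n := n) (by omega) t hη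
    hk01 hk01 E (fun u hu => by
      simp only [hE, Finset.mem_filter, Finset.mem_univ, true_and] at hu
      exact hu.1) (fun s => by
      -- Inside the cutoff the error is that of the cell, at most `η`. Outside, `k` is replaced by
      -- `0`, and its size is at most `η` at the truncated string plus `η` for the truncation.
      have h1 := abs_le.1 (hclose s)
      split_ifs with hs
      · rw [abs_le]
        constructor <;> linarith
      · have h2 := hfar s hs
        have h3 := (hk01 s).1
        rw [abs_le]
        constructor <;> linarith)
  rw [evolutionDilation_generator r σ T hab hm]
  refine hV.implementableWithin hVU ?_
  have hEc : E.card ≤ 2 * L + 1 := card_filter_waveNumber_le hm hK hδ0 hX hL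
  -- From `3 + 10 n ≤ 13 m`, the cells cost at most `(26L + 13) m`; the rest is `2tm + 3m + 1 ≤ 2tm
  -- + 4m`.
  have hnat : 2 * (m * (t + 1)) + m + (E.card * (3 + 10 * n) + 1) ≤ m * (2 * t + 26 * L + 17) := by
    have h1 : E.card * (3 + 10 * n) ≤ (2 * L + 1) * (13 * m) :=
      Nat.mul_le_mul hEc (by omega)
    nlinarith
  exact_mod_cast hnat

end Truncation

/-! ### Choice of the parameters -/

section Parameters

variable {m : ℕ}

/-- By `π ≤ 4`, it is enough that `2^t ≥ 16 m / ε`. -/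
theorem exists_cutoff (hm : 1 ≤ m) {ε : ℝ} (hε : 0 < ε) (hε1 : ε ≤ 1) :
    ∃ t : ℕ, 2 * (m * (Real.pi / 2 ^ t)) ≤ ε / 2 ∧
      (t : ℝ) ≤ Real.log (16 * m / ε) / Real.log 2 + 1 := by
  have hm1 : (1 : ℝ) ≤ m := by exact_mod_cast hm
  have h2 : 0 < Real.log 2 := Real.log_pos (by norm_num)
  have hx : 1 ≤ 16 * m / ε := by
    rw [le_div_iff₀ hε]; linarith
  have hlog : 0 ≤ Real.log (16 * m / ε) / Real.log 2 := div_nonneg (Real.log_nonneg hx) h2.le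
  refine ⟨⌈Real.log (16 * m / ε) / Real.log 2⌉₊, ?_, (Nat.ceil_lt_add_one hlog).le⟩
  set t := ⌈Real.log (16 * m / ε) / Real.log 2⌉₊
  have h3 : Real.log (16 * m / ε) / Real.log 2 ≤ t := Nat.le_ceil _
  rw [div_le_iff₀ h2, ← Real.log_pow, Real.log_le_log_iff (by linarith) (by positivity),
    div_le_iff₀ hε] at h3
  have hpi := Real.pi_le_four
  have hp : (0 : ℝ) < 2 ^ t := by positivity
  rw [← mul_div_assoc, ← mul_div_assoc, div_le_iff₀ hp]
  nlinarith

/-- The choice `η = ε²/24` makes `√(6η) = ε/2`, the other half going to the Fourier transforms. The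
cutoff is `X = 1 - log η`: since `X ≥ 1`, `X² ≥ X ≥ -log η`. -/
theorem implementableWithin_of_scale (r σ T : ℝ) {a b : ℝ} (hr : 0 ≤ r) (hab : a < b) (hT : 0 ≤ T)
    (hm : 1 ≤ m) {δ : ℝ} (hδ : δ = Real.sqrt (T * (σ ^ 2 / 2)) * (2 * Real.pi / (b - a)))
    {K L : ℕ} (hK : K ≤ m) {ε : ℝ} (hε : 0 < ε) (hε1 : ε ≤ 1)
    (hKη : K = 0 ∨ δ * 2 ^ K ≤ ε ^ 2 / 24)
    (hL : K = m ∨ 1 - Real.log (ε ^ 2 / 24) ≤ δ * 2 ^ K * L) :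
    ImplementableWithin m (evolutionDilation (generator r σ a b m) T) ε
      (m * (2 * (Real.log (16 * m / ε) / Real.log 2 + 1) + 26 * L + 17)) := by
  obtain ⟨t, ht, ht'⟩ := exists_cutoff hm hε hε1
  have hη : 0 < ε ^ 2 / 24 := by positivity
  have hη1 : ε ^ 2 / 24 ≤ 1 := by nlinarith
  have hlog : Real.log (ε ^ 2 / 24) ≤ 0 := Real.log_nonpos hη.le hη1
  refine (exists_implementable r σ T hr hab hT hm hδ hK t hη.le (by linarith) hKη ?_ hL).mono
    ?_ ?_
  · rw [← Real.le_log_iff_exp_le hη]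
    nlinarith
  · have : Real.sqrt (6 * (ε ^ 2 / 24)) = ε / 2 := by
      rw [show 6 * (ε ^ 2 / 24) = (ε / 2) ^ 2 by ring, Real.sqrt_sq (by linarith)]
    linarith
  · gcongr

/-- Take the cells as long as the accuracy permits: either a cell twice as long would reach the
tolerance, or one cell holds all wave numbers. -/
theorem exists_scale (m : ℕ) {δ η : ℝ} :
    ∃ K ≤ m, (K = 0 ∨ δ * 2 ^ K ≤ η) ∧ (K = m ∨ η ≤ δ * 2 ^ (K + 1)) := by
  induction m with
  | zero => exact ⟨0, le_rfl, Or.inl rfl, Or.inl rfl⟩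
  | succ m ih =>
    obtain ⟨K, hK, h1, h2⟩ := ih
    rcases h2 with rfl | h2
    · by_cases h : η ≤ δ * 2 ^ (K + 1)
      · exact ⟨K, by omega, h1, Or.inr h⟩
      · exact ⟨K + 1, le_rfl, Or.inr (not_le.1 h).le, Or.inl rfl⟩
    · exact ⟨K, by omega, h1, Or.inr h2⟩

theorem implementable_fixed_accuracy {ε : ℝ} (hε : 0 < ε) :
    ∃ C : ℝ, ∀ (r σ a b T : ℝ) (m : ℕ), 0 ≤ r → a < b → 0 ≤ T → 2 ≤ m →
      ImplementableWithin m (evolutionDilation (generator r σ a b m) T)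
        ε (C * ((m : ℝ) * Real.log m)) := by
  wlog hε1 : ε ≤ 1 generalizing ε
  · obtain ⟨C, hC⟩ := this one_pos le_rfl
    exact ⟨C, fun r σ a b T m hr hab hT hm => (hC r σ a b T m hr hab hT hm).mono
      (not_le.1 hε1).le le_rfl⟩
  have h2 : 0 < Real.log 2 := Real.log_pos (by norm_num)
  set η := ε ^ 2 / 24 with hη
  have hη0 : 0 < η := by positivity
  -- Unless `K = m`, the scale satisfies `δ 2^K ≥ η/2`, so this `L` works for every `δ`; this is the
  -- source of uniformity in the data.
  set L := ⌈2 * (1 - Real.log η) / η⌉₊ with hL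
  have hL' : 1 - Real.log η ≤ η / 2 * L := by
    have := Nat.le_ceil (2 * (1 - Real.log η) / η)
    rw [← hL, div_le_iff₀ hη0] at this
    linarith
  set A := Real.log (16 / ε) / Real.log 2 with hA
  have hA0 : 0 ≤ A := by
    refine div_nonneg (Real.log_nonneg ?_) h2.le
    rw [le_div_iff₀ hε]; linarith
  refine ⟨(2 * A + 26 * L + 21) / Real.log 2, fun r σ a b T m hr hab hT hm => ?_⟩
  obtain ⟨K, hK, h3, h4⟩ := exists_scale m
    (δ := Real.sqrt (T * (σ ^ 2 / 2)) * (2 * Real.pi / (b - a))) (η := η)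
  refine (implementableWithin_of_scale r σ T hr hab hT (by omega) rfl hK (L := L) hε hε1 h3
    (h4.imp id fun h => ?_)).mono le_rfl ?_
  · rw [pow_succ _ K] at h
    refine hL'.trans ?_
    gcongr
    linarith
  · have hm0 : (0 : ℝ) < m := by positivity
    have hlm : Real.log 2 ≤ Real.log m :=
      Real.log_le_log (by norm_num) (by exact_mod_cast hm)
    have e1 : Real.log (16 * m / ε) / Real.log 2 = A + Real.log m / Real.log 2 := by
      rw [hA, ← add_div, ← Real.log_mul (by positivity) (by positivity)]
      congr 2
      ring
    have e2 : 1 ≤ Real.log m / Real.log 2 := by rwa [one_le_div h2]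
    have hL0 : (0 : ℝ) ≤ L := Nat.cast_nonneg L
    rw [e1]
    calc (m : ℝ) * (2 * (A + Real.log m / Real.log 2 + 1) + 26 * L + 17)
        ≤ m * ((2 * A + 26 * L + 21) * (Real.log m / Real.log 2)) := by
          refine mul_le_mul_of_nonneg_left ?_ hm0.le
          nlinarith
      _ = _ := by ring

theorem implementable_polynomial_accuracy {r a b T : ℝ} (σ : ℝ) (c : ℕ) (hr : 0 ≤ r) (hab : a < b)
    (hT : 0 ≤ T) :
    ∃ C : ℝ, ∀ m : ℕ, 2 ≤ m →
      ImplementableWithin m (evolutionDilation (generator r σ a b m) T)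
        (1 / (m : ℝ) ^ c) (C * ((m : ℝ) * Real.log m)) := by
  have h2 : 0 < Real.log 2 := Real.log_pos (by norm_num)
  set δ := Real.sqrt (T * (σ ^ 2 / 2)) * (2 * Real.pi / (b - a)) with hδ
  have hδ0 : 0 ≤ δ := by
    have : 0 < b - a := sub_pos.2 hab
    rw [hδ]; positivity
  have h16 : 0 ≤ Real.log 16 := Real.log_nonneg (by norm_num)
  have h24 : 0 ≤ Real.log 24 := Real.log_nonneg (by norm_num)
  set P := (1 + Real.log 24) / δ with hP
  have hP0 : 0 ≤ P := by positivity
  refine ⟨(2 * (Real.log 16 / Real.log 2 + (c + 1)) + 26 * (P + 2 * c / δ) + 45) / Real.log 2,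
    fun m hm => ?_⟩
  have hm0 : (0 : ℝ) < m := by positivity
  have hm1 : (1 : ℝ) ≤ m := by exact_mod_cast (by omega : 1 ≤ m)
  have hlm : Real.log 2 ≤ Real.log m := Real.log_le_log (by norm_num) (by exact_mod_cast hm)
  have hlm0 : 0 ≤ Real.log m := h2.le.trans hlm
  have hε : (0 : ℝ) < 1 / (m : ℝ) ^ c := by positivity
  have hε1 : 1 / (m : ℝ) ^ c ≤ 1 := by
    rw [div_le_one (by positivity)]; exact one_le_pow₀ hm1
  have hX : 1 - Real.log ((1 / (m : ℝ) ^ c) ^ 2 / 24) = 1 + Real.log 24 + 2 * c * Real.log m := by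
    rw [Real.log_div (by positivity) (by norm_num), Real.log_pow, Real.log_div one_ne_zero
      (by positivity), Real.log_one, Real.log_pow]
    push_cast
    ring
  have hT' : Real.log (16 * m / (1 / (m : ℝ) ^ c)) = Real.log 16 + (c + 1) * Real.log m := by
    rw [div_div_eq_mul_div, div_one, mul_assoc, ← pow_succ', Real.log_mul (by norm_num)
      (by positivity), Real.log_pow]
    push_cast
    ring
  obtain ⟨K, L, hK, h3, h4, h5⟩ : ∃ K L : ℕ, K ≤ m ∧
      (K = 0 ∨ δ * 2 ^ K ≤ (1 / (m : ℝ) ^ c) ^ 2 / 24) ∧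
      (K = m ∨ 1 - Real.log ((1 / (m : ℝ) ^ c) ^ 2 / 24) ≤ δ * 2 ^ K * L) ∧
      (L : ℝ) ≤ P + 2 * c / δ * Real.log m + 1 := by
    rcases hδ0.eq_or_lt with h0 | h0
    · refine ⟨m, 0, le_rfl, Or.inr ?_, Or.inl rfl, ?_⟩
      · rw [← h0, zero_mul]; positivity
      · rw [Nat.cast_zero]; positivity
    · have hq : (1 + Real.log 24 + 2 * c * Real.log m) / δ = P + 2 * c / δ * Real.log m := by
        rw [hP]; ring
      -- For `δ > 0` every mode is its own cell, with no truncation error; the cutoff grows like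
      -- `log m`, hence so does `L`.
      refine ⟨0, ⌈(1 + Real.log 24 + 2 * c * Real.log m) / δ⌉₊, by omega, Or.inl rfl,
        Or.inr ?_, ?_⟩
      · rw [hX, pow_zero, mul_one, mul_comm δ, ← div_le_iff₀ h0]
        exact Nat.le_ceil _
      · rw [← hq]
        exact (Nat.ceil_lt_add_one (by positivity)).le
  refine (implementableWithin_of_scale r σ T hr hab hT (by omega) hδ hK hε hε1 h3 h4).mono
    le_rfl ?_
  rw [hT']
  set y := Real.log m / Real.log 2 with hy
  have hy1 : 1 ≤ y := by rw [hy]; rwa [one_le_div h2]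
  set D := 2 * c / δ with hD
  have hD0 : 0 ≤ D := by positivity
  have hl2 : Real.log 2 ≤ 1 := by linarith [Real.log_two_lt_d9]
  have hly : Real.log m = y * Real.log 2 := by rw [hy]; field_simp
  have e1 : (Real.log 16 + (c + 1) * Real.log m) / Real.log 2
      = Real.log 16 / Real.log 2 + (c + 1) * y := by rw [hy]; ring
  have hA0 : 0 ≤ Real.log 16 / Real.log 2 := by positivity
  rw [e1]
  have hc0 : (0 : ℝ) ≤ c := Nat.cast_nonneg c
  have hDl : D * Real.log m ≤ D * y := by
    rw [hly]
    refine mul_le_mul_of_nonneg_left ?_ hD0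
    nlinarith
  have hAy : Real.log 16 / Real.log 2 ≤ Real.log 16 / Real.log 2 * y :=
    le_mul_of_one_le_right hA0 hy1
  have hPy : P ≤ P * y := le_mul_of_one_le_right hP0 hy1
  have key : 2 * (Real.log 16 / Real.log 2 + (c + 1) * y + 1) + 26 * (L : ℝ) + 17
      ≤ (2 * (Real.log 16 / Real.log 2 + (c + 1)) + 26 * (P + D) + 45) * y := by
    linarith
  calc (m : ℝ) * (2 * (Real.log 16 / Real.log 2 + (c + 1) * y + 1) + 26 * L + 17)
      ≤ m * ((2 * (Real.log 16 / Real.log 2 + (c + 1)) + 26 * (P + D) + 45) * y) :=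
        mul_le_mul_of_nonneg_left key hm0.le
    _ = _ := by rw [hy]; ring

end Parameters

end BlackScholes

end

theorem theorem4p2 :
    -- the two parts are simultaneously diagonal in the momentum basis and commute, and one
    -- unitary dilation step of length `T` yields the semi-discrete solution at time `T`
    (∀ (r σ a b T : ℝ) (m : ℕ), 0 ≤ r → a < b → 0 ≤ T → 1 ≤ m →
      BlackScholes.inMomentumBasis a b m
          (BlackScholes.hermPart (BlackScholes.generator r σ a b m))
        = Matrix.diagonal
            (fun l => ((-(σ ^ 2 / 2 * BlackScholes.freq a b m l ^ 2 + r) : ℝ) : ℂ)) ∧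
      BlackScholes.inMomentumBasis a b m
          (BlackScholes.antiHermPart (BlackScholes.generator r σ a b m))
        = Matrix.diagonal
            (fun l => (((r - σ ^ 2 / 2) * BlackScholes.freq a b m l : ℝ) : ℂ)) ∧
      Commute
        (BlackScholes.inMomentumBasis a b m
          (BlackScholes.hermPart (BlackScholes.generator r σ a b m)))
        (BlackScholes.inMomentumBasis a b m
          (BlackScholes.antiHermPart (BlackScholes.generator r σ a b m))) ∧
      Commute
        (BlackScholes.hermPart (BlackScholes.generator r σ a b m))
        (BlackScholes.antiHermPart (BlackScholes.generator r σ a b m)) ∧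
      BlackScholes.evolutionDilation (BlackScholes.generator r σ a b m) T
        ∈ Matrix.unitaryGroup (Fin 2 × Fin (2 ^ m)) ℂ ∧
      (∀ V : ℝ → Fin (2 ^ m) → ℂ,
        (∀ t ∈ Set.Icc 0 T, HasDerivWithinAt V
          ((BlackScholes.generator r σ a b m).mulVec (V t)) (Set.Icc 0 T) t) →
        ∀ j, (BlackScholes.evolutionDilation (BlackScholes.generator r σ a b m) T).mulVec
          (BlackScholes.ketZero (V 0)) (0, j) = V T j)) ∧
    -- `O(m log m)` gates for every fixed accuracy, uniformly in the data of the problem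
    (∀ ε : ℝ, 0 < ε → ∃ C : ℝ, ∀ (r σ a b T : ℝ) (m : ℕ),
      0 ≤ r → a < b → 0 ≤ T → 2 ≤ m →
      BlackScholes.ImplementableWithin m
        (BlackScholes.evolutionDilation (BlackScholes.generator r σ a b m) T)
        ε (C * ((m : ℝ) * Real.log m))) ∧
    -- `O(m log m)` gates for every inverse polynomial accuracy, for fixed data
    (∀ (r σ a b T : ℝ) (c : ℕ), 0 ≤ r → a < b → 0 ≤ T → ∃ C : ℝ, ∀ m : ℕ, 2 ≤ m →
      BlackScholes.ImplementableWithin m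
        (BlackScholes.evolutionDilation (BlackScholes.generator r σ a b m) T)
        (1 / (m : ℝ) ^ c) (C * ((m : ℝ) * Real.log m))) := by
  exact ⟨BlackScholes.generator_dilation_spec,
    fun _ hε => BlackScholes.implementable_fixed_accuracy hε,
    fun _ σ _ _ _ c hr hab hT => BlackScholes.implementable_polynomial_accuracy σ c hr hab hT⟩
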